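/- Let $K$ be a field of characteristic different from $2$. For an $[n,k,d]$-linear code over $K$ with generating matrix $G$ (i.e. the image of the injective map $K^k\to K^n$, $x\mapsto xG$, with $d$ the smallest number of nonzero entries of a nonzero codeword), let $\ell_1,\dots,\ell_n\in K[x_1,\dots,x_k]$ be the linear forms dual to the columns of $G$, and assume that $\gcd(\ell_i,\ell_j)=1$ for $i\ne j$. Its Orlik–Terao algebra is $\mathrm{OT}=S/\ker\phi$, where $S=K[y_1,\dots,y_n]$ and $\phi:S\to K(x_1,\dots,x_k)$ is the $K$-algebra homomorphism with $\phi(y_i)=1/\ell_i$; it is graded by the degree in the $y_i$. (1) The forms $(x,y,z,x-y,x-z,y-z)$ define a $[6,3,3]$-linear code $\mathcal C_1$ and the forms $(x,y,x+y,x-y,z,y-z)$ define a $[6,3,2]$-linear code $\mathcal C_2$. In both cases the forms are pairwise coprime, and for both codes the minimal graded free resolution of the Orlik–Terao algebra over $S=K[y_1,\dots,y_6]$ has the shape $$0\to S^2(-5)\to S^3(-4)\oplus S^2(-3)\to S^4(-2)\to S\to \mathrm{OT}(\mathcal C_i)\to 0 .$$ (2) Consequently the minimum distance is not determined by the graded Betti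 numbers of the Orlik–Terao algebra, not even together with the length and the dimension: there is no function $f$ such that $d=f(n,k,\beta)$ for every $[n,k,d]$-linear code over $K$ with pairwise coprime forms, where $\beta=(\beta_{i,j})$ is the table of graded Betti numbers of its Orlik–Terao algebra over $K[y_1,\dots,y_n]$. -/

import Mathlib

/-! ### Linear codes given by a generating matrix -/

/-- The code with generating matrix `G`: the image of `K ^ k → K ^ n`, `x ↦ x G`. -/
def matrixCode {K : Type*} [Field K] {n k : ℕ} (G : Matrix (Fin k) (Fin n) K) :
    Submodule K (Fin n → K) :=
  LinearMap.range G.vecMulLinear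

/-- `C` is an `[n, k, d]`-linear code: a `k`-dimensional subspace of `K ^ n` for which `d` is the
smallest number of nonzero entries of a nonzero codeword. -/
def IsLinearCode {K : Type*} [Field K] [DecidableEq K] {n : ℕ} (C : Submodule K (Fin n → K))
    (k d : ℕ) : Prop :=
  Module.finrank K C = k ∧ IsLeast {w : ℕ | ∃ c ∈ C, c ≠ 0 ∧ hammingNorm c = w} d

/-- The linear forms `ℓ₁, …, ℓₙ` in `K[x₁, …, xₖ]` dual to the columns of `G`. -/
noncomputable def linearForms {K : Type*} [Field K] {n k : ℕ} (G : Matrix (Fin k) (Fin n) K) :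
    Fin n → MvPolynomial (Fin k) K :=
  fun j => ∑ i, MvPolynomial.C (G i j) * MvPolynomial.X i

/-! ### The Orlik–Terao algebra -/

/-- The homomorphism `K[y₁, …, yₙ] → K(x₁, …, xₖ)`, `yᵢ ↦ 1 / ℓᵢ`, whose image is the subalgebra
`K[1 / ℓ₁, …, 1 / ℓₙ]`. -/
noncomputable def orlikTeraoMap {K : Type*} [Field K] {n k : ℕ}
    (ℓ : Fin n → MvPolynomial (Fin k) K) :
    MvPolynomial (Fin n) K →ₐ[K] FractionRing (MvPolynomial (Fin k) K) :=
  MvPolynomial.aeval fun i =>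
    (algebraMap (MvPolynomial (Fin k) K) (FractionRing (MvPolynomial (Fin k) K)) (ℓ i))⁻¹

/-- The Orlik–Terao ideal of the forms `ℓ`. -/
noncomputable def orlikTeraoIdeal {K : Type*} [Field K] {n k : ℕ}
    (ℓ : Fin n → MvPolynomial (Fin k) K) : Ideal (MvPolynomial (Fin n) K) :=
  RingHom.ker (orlikTeraoMap ℓ)

/-- The Orlik–Terao algebra of the forms `ℓ`. -/
abbrev OrlikTeraoAlgebra {K : Type*} [Field K] {n k : ℕ}
    (ℓ : Fin n → MvPolynomial (Fin k) K) : Type _ :=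
  MvPolynomial (Fin n) K ⧸ orlikTeraoIdeal ℓ

/-- The homogeneous components of the Orlik–Terao algebra: the component of degree `e` consists
of the classes of the homogeneous polynomials of degree `e`. -/
noncomputable def orlikTeraoGrading {K : Type*} [Field K] {n k : ℕ}
    (ℓ : Fin n → MvPolynomial (Fin k) K) (e : ℕ) : Submodule K (OrlikTeraoAlgebra ℓ) :=
  (MvPolynomial.homogeneousSubmodule (Fin n) K e).map
    (Ideal.Quotient.mkₐ K (orlikTeraoIdeal ℓ)).toLinearMap

/-! ### Minimal graded free resolutions -/

/-- The graded free module `⨁ⱼ S(-j) ^ (b j)` over `S = K[y₁, …, yₙ]`. The basis element with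
index `⟨j, t⟩` has degree `j`. -/
abbrev GradedFree (K : Type*) [Field K] (n : ℕ) (b : ℕ → ℕ) : Type _ :=
  (Σ j : ℕ, Fin (b j)) →₀ MvPolynomial (Fin n) K

/-- `v` lies in the component of degree `e` of `⨁ⱼ S(-j) ^ (b j)`: its coordinate at a basis
element of degree `j` involves only monomials of degree `e - j` (none if `e < j`). -/
def GradedFree.IsHomogeneous {K : Type*} [Field K] {n : ℕ} {b : ℕ → ℕ} (v : GradedFree K n b)
    (e : ℕ) : Prop :=
  ∀ p : Σ j : ℕ, Fin (b j), ∀ m ∈ (v p).support, m.degree + p.1 = e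

/-- A minimal graded free resolution
`⋯ → ⨁ⱼ S(-j) ^ (β 1 j) → ⨁ⱼ S(-j) ^ (β 0 j) → M → 0`
over `S = K[y₁, …, yₙ]` of an `S`-module `M` with homogeneous components `𝓜 e`. -/
structure MinimalGradedFreeResolution {K : Type*} [Field K] {n : ℕ} {M : Type*} [AddCommGroup M]
    [Module K M] [Module (MvPolynomial (Fin n) K) M] [IsScalarTower K (MvPolynomial (Fin n) K) M]
    (𝓜 : ℕ → Submodule K M)
    (β : ℕ → ℕ → ℕ) where
  /-- the augmentation -/
  aug : GradedFree K n (β 0) →ₗ[MvPolynomial (Fin n) K] M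
  /-- the differentials -/
  diff : ∀ i : ℕ, GradedFree K n (β (i + 1)) →ₗ[MvPolynomial (Fin n) K] GradedFree K n (β i)
  aug_homogeneous : ∀ (v : GradedFree K n (β 0)) (e : ℕ), v.IsHomogeneous e → aug v ∈ 𝓜 e
  diff_homogeneous : ∀ (i : ℕ) (v : GradedFree K n (β (i + 1))) (e : ℕ),
    v.IsHomogeneous e → GradedFree.IsHomogeneous (diff i v) e
  aug_surjective : Function.Surjective aug
  exact_zero : Function.Exact (diff 0) aug
  exact_succ : ∀ i : ℕ, Function.Exact (diff (i + 1)) (diff i)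
  /-- minimality: the image of each differential lies in `(y₁, …, yₙ)` times its target -/
  minimal : ∀ i : ℕ, LinearMap.range (diff i) ≤
    Ideal.span (Set.range (MvPolynomial.X : Fin n → MvPolynomial (Fin n) K)) •
      (⊤ : Submodule (MvPolynomial (Fin n) K) (GradedFree K n (β i)))

/-- `β` is the table of graded Betti numbers of the Orlik–Terao algebra of the forms `ℓ`: in its
minimal graded free resolution over `S = K[y₁, …, yₙ]` the `i`-th free module is
`⨁ⱼ S(-j) ^ (β i j)`. -/
def IsOrlikTeraoBetti {K : Type*} [Field K] {n k : ℕ} (ℓ : Fin n → MvPolynomial (Fin k) K)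
    (β : ℕ → ℕ → ℕ) : Prop :=
  Nonempty (MinimalGradedFreeResolution (n := n) (orlikTeraoGrading ℓ) β)

/-- The Betti table of a resolution of the shape
`0 → S(-5)² → S(-4)³ ⊕ S(-3)² → S(-2)⁴ → S`. -/
def commonBettiTable : ℕ → ℕ → ℕ
  | 0, 0 => 1
  | 1, 2 => 4
  | 2, 3 => 2
  | 2, 4 => 3
  | 3, 5 => 2
  | _, _ => 0

/-!
A relation `α ℓᵢ + β ℓⱼ + γ ℓₗ = 0` gives the quadric `α yⱼ yₗ + β yᵢ yₗ + γ yᵢ yⱼ` of the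
Orlik–Terao ideal. Group the forms by their last variable, and suppose that any two forms of a group
satisfy such a relation with a form of an earlier group. Modulo these quadrics, a polynomial in the
variables `yᵢ` of one group with coefficients in the earlier ones reduces to a combination of powers
of single variables. Under `yᵢ ↦ 1 / ℓᵢ` these powers become partial fractions, which are linearly
independent, so the quadrics generate the ideal.

For both codes the four quadrics can be chosen as a prime `q` together with the maximal minors
`m₀, m₁, m₂` of a `3 × 2` matrix of linear forms. As `q ∤ m₀`, `(q, m₀)` is prime and
`m₁ ∉ (q, m₀)`, tensoring the Hilbert–Burch complex of the minors with the Koszul complex of `q`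
gives a minimal resolution, whose shape does not depend on the code.
-/

section PartialFractions

variable {ι : Type*}

/-- The family consisting of `1` and of the positive powers of the `u i`; partial fraction
expansions are its linear combinations. -/
def powerFamily {R : Type*} [Monoid R] (u : ι → R) : Option (ι × ℕ) → R
  | none => 1
  | some (i, m) => u i ^ (m + 1)

theorem span_powerFamily_eq_adjoin {A R : Type*} [CommRing A] [CommRing R] [Algebra A R]
    {u : ι → R} (hu : Pairwise fun i j => u i * u j ∈ Submodule.span A {u i, u j}) :
    Submodule.span A (Set.range (powerFamily u)) =
      Subalgebra.toSubmodule (Algebra.adjoin A (Set.range u)) := by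
  set N := Submodule.span A (Set.range (powerFamily u))
  have hpow (i : ι) (m : ℕ) : u i ^ (m + 1) ∈ N := Submodule.subset_span ⟨some (i, m), rfl⟩
  have hmul_pow (i j : ι) (m : ℕ) : u j * u i ^ (m + 1) ∈ N := by
    rcases eq_or_ne i j with rfl | hij
    · simpa only [pow_succ'] using hpow i (m + 1)
    obtain ⟨a, b, hab⟩ := Submodule.mem_span_pair.mp (hu hij)
    induction m with
    | zero =>
      rw [zero_add, pow_one, mul_comm, ← hab]
      exact add_mem (N.smul_mem a (by simpa using hpow i 0))
        (N.smul_mem b (by simpa using hpow j 0))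
    | succ m ih =>
      have hred : u j * u i ^ (m + 2) = a • u i ^ (m + 2) + b • (u j * u i ^ (m + 1)) := by
        simp only [Algebra.smul_def] at hab ⊢
        linear_combination -u i ^ (m + 1) * hab
      rw [hred]
      exact add_mem (N.smul_mem a (hpow i _)) (N.smul_mem b ih)
  have hmul (j : ι) : ∀ x ∈ N, u j * x ∈ N := fun x hx => by
    induction hx using Submodule.span_induction with
    | mem x hx =>
      obtain ⟨_ | ⟨i, m⟩, rfl⟩ := hx
      · simpa [powerFamily] using hpow j 0
      · exact hmul_pow i j m
    | zero => simp
    | add x y _ _ hx hy => simpa only [mul_add] using add_mem hx hy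
    | smul a x _ hx => simpa only [mul_smul_comm] using N.smul_mem a hx
  refine le_antisymm (Submodule.span_le.mpr ?_) ?_
  · rintro _ ⟨_ | ⟨i, m⟩, rfl⟩
    · exact one_mem (Algebra.adjoin A _)
    · exact (Algebra.adjoin A _).pow_mem (Algebra.subset_adjoin (Set.mem_range_self i)) _
  · rw [Algebra.adjoin_eq_span, Submodule.span_le]
    intro x hx
    induction hx using Submonoid.closure_induction_left with
    | one => exact Submodule.subset_span ⟨none, rfl⟩
    | mul_left y hy x _ hx =>
      obtain ⟨j, rfl⟩ := hy
      exact hmul j x hx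

variable {F L : Type*} [Field F] [Field L] [Algebra F L]

theorem eq_zero_of_sum_mul_inv_sub_pow_eq_zero {z : L} (hz : Transcendental F z) {c : ι → F}
    (hc : Function.Injective c) (T : Finset ι) (N : ℕ) (a : F) (b : ι → Fin N → F)
    (h : algebraMap F L a +
      ∑ i ∈ T, ∑ m, algebraMap F L (b i m) * (z - algebraMap F L (c i))⁻¹ ^ (m.1 + 1) = 0) :
    a = 0 ∧ ∀ i ∈ T, b i = 0 := by
  let _ : Algebra (Polynomial F) L := (Polynomial.aeval z).toRingHom.toAlgebra
  have hmap (p : Polynomial F) : algebraMap (Polynomial F) L p = Polynomial.aeval z p := rfl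
  have hinj : Function.Injective (algebraMap (Polynomial F) L) := transcendental_iff_injective.mp hz
  have : FaithfulSMul (Polynomial F) L := (faithfulSMul_iff_algebraMap_injective _ _).mpr hinj
  have hne (i : ι) : z - algebraMap F L (c i) ≠ 0 := fun h =>
    Polynomial.X_sub_C_ne_zero (c i) (hinj (by simpa [hmap] using h))
  have hunique := Polynomial.quo_add_sum_rem_mul_pow_inverse_unique (R := F) (K := L)
    (s := T) (g := fun i => Polynomial.X - Polynomial.C (c i))
    (fun i _ => Polynomial.monic_X_sub_C _)
    (fun i _ j _ hij => Polynomial.isCoprime_X_sub_C_of_isUnit_sub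
      (IsUnit.mk0 _ (sub_ne_zero.mpr (hc.ne hij))))
    (n := fun _ => N) (gi := fun i => (z - algebraMap F L (c i))⁻¹)
    (fun i _ => by simpa [hmap] using inv_mul_cancel₀ (hne i))
    (q₁ := Polynomial.C a) (q₂ := 0) (r₁ := fun i m => Polynomial.C (b i m)) (r₂ := fun _ _ => 0)
    (fun _ _ _ => by simpa using Polynomial.degree_C_lt)
    (fun _ _ _ => by simp)
    (by simpa [hmap] using h)
  refine ⟨by simpa using hunique.1, fun i hi => funext fun m => ?_⟩
  simpa using congrFun (hunique.2 i hi) m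

theorem linearIndependent_powerFamily_inv_sub {z : L} (hz : Transcendental F z) {c : ι → F}
    (hc : Function.Injective c) :
    LinearIndependent F (powerFamily fun i => (z - algebraMap F L (c i))⁻¹) := by
  classical
  refine linearIndependent_iff''.mpr fun s g hgs hg => ?_
  set T := s.eraseNone.image Prod.fst
  set N := s.eraseNone.sup Prod.snd + 1
  have hmem {p : ι × ℕ} (hp : some p ∈ s) : p.1 ∈ T ∧ p.2 < N := by
    rw [← Finset.mem_eraseNone] at hp
    exact ⟨Finset.mem_image_of_mem _ hp, Nat.lt_succ_of_le (Finset.le_sup (f := Prod.snd) hp)⟩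
  have hsT : s ⊆ Finset.insertNone (T ×ˢ Finset.range N) := by
    rintro (_ | p) hp
    · simp
    · simpa using hmem hp
  rw [Finset.sum_subset hsT fun o _ ho => by rw [hgs o ho, zero_smul], Finset.sum_insertNone,
    Finset.sum_product] at hg
  obtain ⟨hnone, hsome⟩ := eq_zero_of_sum_mul_inv_sub_pow_eq_zero hz hc T N (g none)
    (fun i m => g (some (i, m)))
    (by simpa [powerFamily, Algebra.smul_def, Finset.sum_range] using hg)
  rintro (_ | p)
  · exact hnone
  · by_contra hp
    obtain ⟨hpT, hpN⟩ := hmem (by_contra fun h => hp (hgs _ h))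
    exact hp (congrFun (hsome p.1 hpT) ⟨p.2, hpN⟩)

theorem linearIndependent_powerFamily_smul {M : Type*} [CommRing M] [Algebra F M] {u : ι → M}
    (hu : LinearIndependent F (powerFamily u)) {f : ι → F} (hf : ∀ i, f i ≠ 0) :
    LinearIndependent F (powerFamily fun i => f i • u i) := by
  have key := hu.units_smul fun o => o.elim 1 fun p => Units.mk0 (f p.1) (hf p.1) ^ (p.2 + 1)
  convert key using 1
  ext (_ | p)
  · simp [powerFamily]
  · simp [powerFamily, Units.smul_def, smul_pow]

theorem injOn_adjoin_of_linearIndependent {K R : Type*} [Field K] [CommRing R] [Algebra K R]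
    [Algebra K L] (ψ : R →ₐ[K] L) {A : Subalgebra K R} {F : IntermediateField K L}
    (hA : Set.InjOn ψ A) (hAF : Set.MapsTo ψ A F) {u : ι → R}
    (hu : Pairwise fun i j => u i * u j ∈ Submodule.span A {u i, u j})
    (hind : LinearIndependent F (powerFamily (ψ ∘ u))) :
    Set.InjOn ψ (Algebra.adjoin A (Set.range u)) := by
  suffices ∀ r ∈ Algebra.adjoin A (Set.range u), ψ r = 0 → r = 0 from
    fun x hx y hy hxy => sub_eq_zero.mp <| this _ (sub_mem hx hy) (by rw [map_sub, hxy, sub_self])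
  intro r hr hψr
  rw [← Subalgebra.mem_toSubmodule, ← span_powerFamily_eq_adjoin hu,
    Finsupp.mem_span_range_iff_exists_finsupp] at hr
  obtain ⟨l, rfl⟩ := hr
  have hψ : ∑ o ∈ l.support, (⟨ψ (l o), hAF (l o).2⟩ : F) • powerFamily (ψ ∘ u) o = 0 := by
    rw [← hψr, Finsupp.sum, map_sum]
    refine Finset.sum_congr rfl fun o _ => ?_
    rw [Algebra.smul_def (l o), map_mul]
    rcases o with _ | p <;>
      simp [powerFamily, Algebra.smul_def, IntermediateField.algebraMap_apply, map_pow]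
  refine Finset.sum_eq_zero fun o ho => ?_
  have hlo : ψ (l o) = 0 :=
    congrArg Subtype.val (linearIndependent_iff'.mp hind _ _ hψ o ho)
  have : l o = 0 := Subtype.ext (hA (l o).2 (zero_mem A) (by simpa using hlo))
  simp only [this, zero_smul]

end PartialFractions

section FiberType

open MvPolynomial

variable {K : Type*} [Field K] {n k : ℕ}

/-- The quadric of `K[y₁, …, yₙ]` by which the relation `α ℓᵢ + β ℓⱼ + γ ℓₗ = 0` between three
forms contributes to the Orlik–Terao ideal: at `y = 1 / ℓ` it takes the value
`(α ℓᵢ + β ℓⱼ + γ ℓₗ) / (ℓᵢ ℓⱼ ℓₗ)`. -/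
noncomputable def circuitQuadric (i j l : Fin n) (α β γ : K) : MvPolynomial (Fin n) K :=
  C α * X j * X l + C β * X i * X l + C γ * X i * X j

theorem isHomogeneous_circuitQuadric (i j l : Fin n) (α β γ : K) :
    (circuitQuadric i j l α β γ).IsHomogeneous 2 := by
  have h (a : K) (i j : Fin n) : (C a * X i * X j : MvPolynomial (Fin n) K).IsHomogeneous 2 :=
    ((isHomogeneous_C _ a).mul (isHomogeneous_X K i)).mul (isHomogeneous_X K j)
  exact ((h α j l).add (h β i l)).add (h γ i j)

theorem irreducible_of_isHomogeneous_one {σ : Type*} {f : MvPolynomial σ K}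
    (hf : f.IsHomogeneous 1) (h0 : f ≠ 0) : Irreducible f := by
  refine irreducible_of_totalDegree_eq_one (hf.totalDegree h0) fun c hc => ?_
  rw [isUnit_iff_ne_zero]
  rintro rfl
  exact h0 (MvPolynomial.ext _ _ fun m => by simpa using hc m)

theorem isRelPrime_of_eval {σ : Type*} {f g : MvPolynomial σ K} (hf : Irreducible f)
    (v : σ → K) (hfv : eval v f = 0) (hgv : eval v g ≠ 0) : IsRelPrime f g := by
  refine (hf.dvd_or_isRelPrime (n := g)).resolve_left ?_
  rintro ⟨c, rfl⟩
  simp [hfv] at hgv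

theorem prime_circuitQuadric {i j l : Fin n} (hij : i ≠ j) (hil : i ≠ l) (hjl : j ≠ l)
    {α β γ : K} (hα : α ≠ 0) (hβ : β ≠ 0) (hγ : γ ≠ 0) :
    Prime (circuitQuadric i j l α β γ) := by
  have hlin : (C β * X l + C γ * X j : MvPolynomial (Fin n) K).IsHomogeneous 1 :=
    (isHomogeneous_C_mul_X β l).add (isHomogeneous_C_mul_X γ j)
  have hlin0 : (C β * X l + C γ * X j : MvPolynomial (Fin n) K) ≠ 0 := fun h =>
    hβ (by simpa [Pi.single_apply, hjl] using congrArg (eval (Pi.single l 1)) h)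
  have hvars {f : MvPolynomial (Fin n) K} (hf : f ∈ supported K {i}ᶜ) : i ∉ f.vars := fun hi =>
    mem_supported.mp hf (Finset.mem_coe.mpr hi) rfl
  have hC (a : K) : (C a : MvPolynomial (Fin n) K) ∈ supported K {i}ᶜ :=
    (supported K {i}ᶜ).algebraMap_mem a
  have hXj : (X j : MvPolynomial (Fin n) K) ∈ supported K {i}ᶜ := X_mem_supported.mpr hij.symm
  have hXl : (X l : MvPolynomial (Fin n) K) ∈ supported K {i}ᶜ := X_mem_supported.mpr hil.symm
  have hfactor : circuitQuadric i j l α β γ =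
      (C β * X l + C γ * X j) * X i + C α * X j * X l := by
    simp only [circuitQuadric]
    ring
  rw [hfactor, ← irreducible_iff_prime]
  refine irreducible_mul_X_add _ _ i hlin0
    (hvars (add_mem (mul_mem (hC β) hXl) (mul_mem (hC γ) hXj)))
    (hvars (mul_mem (mul_mem (hC α) hXj) hXl))
    (isRelPrime_of_eval (irreducible_of_isHomogeneous_one hlin hlin0)
      (Pi.single l γ - Pi.single j β) ?_ ?_)
  · simp [hjl, hjl.symm, mul_comm]
  · simp [hjl, hjl.symm, hα, hβ, hγ]

/-- The variable `xᵣ` as an element of `K(x₁, …, xₖ)`. -/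
noncomputable def ratVar (K : Type*) [Field K] {k : ℕ} (r : Fin k) :
    FractionRing (MvPolynomial (Fin k) K) :=
  algebraMap (MvPolynomial (Fin k) K) _ (X r)

/-- The form `ℓᵢ` as an element of `K(x₁, …, xₖ)`. -/
noncomputable def ratForm (G : Matrix (Fin k) (Fin n) K) (i : Fin n) :
    FractionRing (MvPolynomial (Fin k) K) :=
  algebraMap (MvPolynomial (Fin k) K) _ (linearForms G i)

theorem ratForm_eq_sum (G : Matrix (Fin k) (Fin n) K) (i : Fin n) :
    ratForm G i = ∑ r, algebraMap K _ (G r i) * ratVar K r := by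
  simp only [ratForm, ratVar, linearForms, map_sum, map_mul, ← algebraMap_eq,
    ← IsScalarTower.algebraMap_apply]

theorem ratForm_ne_zero {G : Matrix (Fin k) (Fin n) K} {i : Fin n} {r : Fin k} (h : G r i ≠ 0) :
    ratForm G i ≠ 0 := by
  have hform : linearForms G i ≠ 0 := fun h0 =>
    h (by simpa [linearForms, Pi.single_apply] using congrArg (eval (Pi.single r 1)) h0)
  simpa [ratForm] using hform

theorem ratForm_add_eq_zero {G : Matrix (Fin k) (Fin n) K} {i j l : Fin n} {α β γ : K}
    (h : ∀ r, α * G r i + β * G r j + γ * G r l = 0) :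
    algebraMap K _ α * ratForm G i + algebraMap K _ β * ratForm G j +
      algebraMap K _ γ * ratForm G l = 0 := by
  simp only [ratForm_eq_sum, Finset.mul_sum, ← Finset.sum_add_distrib, ← mul_assoc,
    ← map_mul (algebraMap K _), ← add_mul, ← map_add, h, map_zero, zero_mul,
    Finset.sum_const_zero]

theorem orlikTeraoMap_X (G : Matrix (Fin k) (Fin n) K) (i : Fin n) :
    orlikTeraoMap (linearForms G) (X i) = (ratForm G i)⁻¹ :=
  aeval_X _ i

theorem circuitQuadric_mem_orlikTeraoIdeal {G : Matrix (Fin k) (Fin n) K} {i j l : Fin n}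
    (hi : ratForm G i ≠ 0) (hj : ratForm G j ≠ 0) (hl : ratForm G l ≠ 0) {α β γ : K}
    (h : ∀ r, α * G r i + β * G r j + γ * G r l = 0) :
    circuitQuadric i j l α β γ ∈ orlikTeraoIdeal (linearForms G) := by
  rw [orlikTeraoIdeal, RingHom.mem_ker]
  simp only [circuitQuadric, map_add, map_mul, algHom_C, orlikTeraoMap_X]
  field_simp
  linear_combination ratForm_add_eq_zero h

/-- The subfield `K(x₁, …, xₛ)` of `K(x₁, …, xₖ)`. -/
noncomputable def coordinateField (K : Type*) [Field K] (k s : ℕ) :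
    IntermediateField K (FractionRing (MvPolynomial (Fin k) K)) :=
  IntermediateField.adjoin K (ratVar K '' {r : Fin k | (r : ℕ) < s})

theorem ratVar_mem_coordinateField {s : ℕ} {r : Fin k} (h : (r : ℕ) < s) :
    ratVar K r ∈ coordinateField K k s :=
  IntermediateField.subset_adjoin _ _ ⟨r, h, rfl⟩

theorem transcendental_ratVar (s : Fin k) :
    Transcendental (coordinateField K k s) (ratVar K s) := by
  have hX : AlgebraicIndependent K (ratVar K : Fin k → _) :=
    (algebraicIndependent_X (Fin k) K).map' (f := IsScalarTower.toAlgHom K _ _)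
      (IsFractionRing.injective _ _)
  exact IntermediateField.transcendental_adjoin_iff.mpr
    (hX.transcendental_adjoin (s := {r : Fin k | (r : ℕ) < s}) (lt_irrefl (s : ℕ)))

theorem ratForm_mem_coordinateField {G : Matrix (Fin k) (Fin n) K} {i : Fin n} {s : ℕ}
    (h : ∀ r : Fin k, s ≤ r → G r i = 0) : ratForm G i ∈ coordinateField K k s := by
  rw [ratForm_eq_sum]
  refine sum_mem fun r _ => ?_
  rcases lt_or_ge (r : ℕ) s with hr | hr
  · exact mul_mem (IntermediateField.algebraMap_mem _ _) (ratVar_mem_coordinateField hr)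
  · simp [h r hr]

theorem ratForm_sub_mem_coordinateField {G : Matrix (Fin k) (Fin n) K} {i : Fin n} {s : Fin k}
    (h : ∀ r, s < r → G r i = 0) :
    ratForm G i - algebraMap K _ (G s i) * ratVar K s ∈ coordinateField K k s := by
  rw [ratForm_eq_sum, ← Finset.add_sum_erase _ _ (Finset.mem_univ s), add_sub_cancel_left]
  refine sum_mem fun r hr => ?_
  rcases lt_or_gt_of_ne (Finset.ne_of_mem_erase hr) with hr | hr
  · exact mul_mem (IntermediateField.algebraMap_mem _ _) (ratVar_mem_coordinateField hr)
  · simp [h r hr]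

/-- The subalgebra generated by the classes of those `yᵢ` whose form `ℓᵢ` involves only the first
`s` variables, `t i` being the last variable of `ℓᵢ`. -/
noncomputable def initialSubalgebra (I : Ideal (MvPolynomial (Fin n) K)) (t : Fin n → Fin k)
    (s : ℕ) : Subalgebra K (MvPolynomial (Fin n) K ⧸ I) :=
  Algebra.adjoin K ((fun i => Ideal.Quotient.mk I (X i)) '' {i | (t i : ℕ) < s})

variable {G : Matrix (Fin k) (Fin n) K} {t : Fin n → Fin k} {I : Ideal (MvPolynomial (Fin n) K)}

theorem mk_X_mem_initialSubalgebra {s : ℕ} {i : Fin n} (h : (t i : ℕ) < s) :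
    Ideal.Quotient.mk I (X i) ∈ initialSubalgebra I t s :=
  Algebra.subset_adjoin ⟨i, h, rfl⟩

theorem coe_initialSubalgebra_succ (s : Fin k) :
    (initialSubalgebra I t (s + 1) : Set (MvPolynomial (Fin n) K ⧸ I)) =
      Algebra.adjoin (initialSubalgebra I t s)
        (Set.range fun i : {i // t i = s} => Ideal.Quotient.mk I (X i.1)) := by
  have hsplit : {i : Fin n | (t i : ℕ) < s + 1} = {i | (t i : ℕ) < s} ∪ {i | t i = s} := by
    ext i
    simp only [Set.mem_ofPred_eq, Set.mem_union, Fin.ext_iff, Nat.lt_succ_iff_lt_or_eq]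
  rw [← Subalgebra.coe_restrictScalars K]
  rw [initialSubalgebra, hsplit, Set.image_union, Algebra.adjoin_union_eq_adjoin_adjoin,
    ← initialSubalgebra, Set.image_eq_range]
  rfl

/-- The map induced on `S / I` by the parametrization `yᵢ ↦ 1 / ℓᵢ`. -/
noncomputable def orlikTeraoLift (hI : I ≤ orlikTeraoIdeal (linearForms G)) :
    (MvPolynomial (Fin n) K ⧸ I) →ₐ[K] FractionRing (MvPolynomial (Fin k) K) :=
  Ideal.Quotient.liftₐ I (orlikTeraoMap (linearForms G)) hI

theorem orlikTeraoLift_mk_X (hI : I ≤ orlikTeraoIdeal (linearForms G)) (i : Fin n) :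
    orlikTeraoLift hI (Ideal.Quotient.mk I (X i)) = (ratForm G i)⁻¹ :=
  orlikTeraoMap_X G i

/-- `t i` is the last variable of `ℓᵢ`, and any two forms with the same last variable `xₛ` have a
linear combination that is a form `ℓₗ` with an earlier last variable; moreover the quadrics of
these relations belong to `I`. -/
structure IsFiberTypePresentation (G : Matrix (Fin k) (Fin n) K) (t : Fin n → Fin k)
    (I : Ideal (MvPolynomial (Fin n) K)) : Prop where
  pivot_ne_zero : ∀ i, G (t i) i ≠ 0
  eq_zero_of_lt : ∀ i r, t i < r → G r i = 0
  exists_circuit : ∀ i j, i < j → t i = t j → ∃ l α β γ, t l < t i ∧ γ ≠ 0 ∧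
    (∀ r, α * G r i + β * G r j + γ * G r l = 0) ∧ circuitQuadric i j l α β γ ∈ I

theorem mapsTo_orlikTeraoLift (hI : I ≤ orlikTeraoIdeal (linearForms G))
    (htri : ∀ i r, t i < r → G r i = 0) (s : ℕ) :
    Set.MapsTo (orlikTeraoLift hI) (initialSubalgebra I t s) (coordinateField K k s) := by
  suffices initialSubalgebra I t s ≤ (coordinateField K k s).toSubalgebra.comap (orlikTeraoLift hI)
    from fun a ha => this ha
  rw [initialSubalgebra, Algebra.adjoin_le_iff]
  rintro _ ⟨i, hi, rfl⟩
  simp only [Subalgebra.coe_comap, Set.mem_preimage, orlikTeraoLift_mk_X]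
  exact (coordinateField K k s).inv_mem (ratForm_mem_coordinateField fun r hr =>
    htri i r (Fin.lt_def.mpr (lt_of_lt_of_le hi hr)))

namespace IsFiberTypePresentation

theorem ratForm_ne_zero (h : IsFiberTypePresentation G t I) (i : Fin n) : ratForm G i ≠ 0 :=
  _root_.ratForm_ne_zero (h.pivot_ne_zero i)

theorem circuitQuadric_mem (h : IsFiberTypePresentation G t I) {i j l : Fin n} {α β γ : K}
    (hrel : ∀ r, α * G r i + β * G r j + γ * G r l = 0) :
    circuitQuadric i j l α β γ ∈ orlikTeraoIdeal (linearForms G) :=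
  circuitQuadric_mem_orlikTeraoIdeal (h.ratForm_ne_zero i) (h.ratForm_ne_zero j)
    (h.ratForm_ne_zero l) hrel

theorem exists_circuit_of_ne (h : IsFiberTypePresentation G t I) {i j : Fin n} (hij : i ≠ j)
    (ht : t i = t j) : ∃ l α β γ, t l < t i ∧ γ ≠ 0 ∧
      (∀ r, α * G r i + β * G r j + γ * G r l = 0) ∧ circuitQuadric i j l α β γ ∈ I := by
  rcases lt_or_gt_of_ne hij with hlt | hlt
  · exact h.exists_circuit i j hlt ht
  · obtain ⟨l, α, β, γ, hl, hγ, hrel, hq⟩ := h.exists_circuit j i hlt ht.symm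
    refine ⟨l, β, α, γ, ht ▸ hl, hγ, fun r => by linear_combination hrel r, ?_⟩
    convert hq using 1
    simp only [circuitQuadric]
    ring

theorem mul_mem_span (h : IsFiberTypePresentation G t I) {i j : Fin n} (hij : i ≠ j)
    (ht : t i = t j) {s : ℕ} (hs : t i = s) :
    Ideal.Quotient.mk I (X i) * Ideal.Quotient.mk I (X j) ∈
      Submodule.span (initialSubalgebra I t s)
        {Ideal.Quotient.mk I (X i), Ideal.Quotient.mk I (X j)} := by
  obtain ⟨l, α, β, γ, hl, hγ, -, hq⟩ := h.exists_circuit_of_ne hij ht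
  have hl : Ideal.Quotient.mk I (X l) ∈ initialSubalgebra I t s :=
    mk_X_mem_initialSubalgebra (hs ▸ hl)
  refine Submodule.mem_span_pair.mpr ⟨⟨_, Subalgebra.smul_mem _ hl (-(γ⁻¹ * β))⟩,
    ⟨_, Subalgebra.smul_mem _ hl (-(γ⁻¹ * α))⟩, ?_⟩
  have hγ' : Ideal.Quotient.mk I (C γ⁻¹) * Ideal.Quotient.mk I (C γ) = 1 := by
    rw [← map_mul, ← C_mul, inv_mul_cancel₀ hγ, C_1, map_one]
  have hq := Ideal.Quotient.eq_zero_iff_mem.mpr hq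
  have halg (a : K) : algebraMap K (_ ⧸ I) a = Ideal.Quotient.mk I (C a) := rfl
  simp only [circuitQuadric, map_add, map_mul] at hq
  simp only [Subalgebra.smul_def, Algebra.smul_def, smul_eq_mul, halg, map_neg, map_mul]
  linear_combination -Ideal.Quotient.mk I (C γ⁻¹) * hq +
    Ideal.Quotient.mk I (X i) * Ideal.Quotient.mk I (X j) * hγ'

theorem inv_mul_ratForm_ne (h : IsFiberTypePresentation G t I) {i j : Fin n} (hij : i ≠ j)
    (ht : t i = t j) : (algebraMap K _ (G (t i) i))⁻¹ * ratForm G i ≠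
      (algebraMap K _ (G (t i) j))⁻¹ * ratForm G j := by
  intro heq
  obtain ⟨l, α, β, γ, hl, hγ, hrel, -⟩ := h.exists_circuit_of_ne hij ht
  set a := algebraMap K (FractionRing (MvPolynomial (Fin k) K))
  have hi : a (G (t i) i) ≠ 0 := by simpa [a] using h.pivot_ne_zero i
  have hj : a (G (t i) j) ≠ 0 := by simpa [a, ht] using h.pivot_ne_zero j
  have hpivot : a α * a (G (t i) i) + a β * a (G (t i) j) = 0 := by
    have hrel_pivot := hrel (t i)
    rw [h.eq_zero_of_lt l _ hl, mul_zero, add_zero] at hrel_pivot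
    rw [← map_mul, ← map_mul, ← map_add, hrel_pivot, map_zero]
  refine mul_ne_zero ((map_ne_zero a).mpr hγ) (h.ratForm_ne_zero l) ?_
  rw [← ratForm_add_eq_zero hrel]
  field_simp at heq
  refine mul_left_cancel₀ hj ?_
  linear_combination -(a α * heq) - ratForm G j * hpivot

theorem exists_pole (h : IsFiberTypePresentation G t I) (i : Fin n) :
    ∃ c : coordinateField K k (t i),
      (c : FractionRing (MvPolynomial (Fin k) K)) =
        ratVar K (t i) - (algebraMap K _ (G (t i) i))⁻¹ * ratForm G i := by
  refine ⟨⟨_, mul_mem (neg_mem (inv_mem (algebraMap_mem _ (G (t i) i))))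
    (ratForm_sub_mem_coordinateField (h.eq_zero_of_lt i))⟩, ?_⟩
  have hi : algebraMap K (FractionRing (MvPolynomial (Fin k) K)) (G (t i) i) ≠ 0 := by
    simpa using h.pivot_ne_zero i
  field_simp
  ring

theorem exists_injective_pole (h : IsFiberTypePresentation G t I) (s : Fin k) :
    ∃ c f : {i // t i = s} → coordinateField K k s, Function.Injective c ∧ (∀ i, f i ≠ 0) ∧
      (fun i : {i // t i = s} => (ratForm G i.1)⁻¹) =
        fun i => f i • (ratVar K s - algebraMap (coordinateField K k s) _ (c i))⁻¹ := by
  have hpole (i : {i // t i = s}) : ∃ c : coordinateField K k s,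
      (c : FractionRing (MvPolynomial (Fin k) K)) =
        ratVar K s - (algebraMap K _ (G s i))⁻¹ * ratForm G i := by
    obtain ⟨i, rfl⟩ := i
    exact h.exists_pole i
  have hpivot (i : {i // t i = s}) : G s i ≠ 0 := by simpa [i.2] using h.pivot_ne_zero i
  choose c hc using hpole
  refine ⟨c, fun i => algebraMap K _ (G s i)⁻¹, fun i j hij => ?_, fun i => ?_, funext fun i => ?_⟩
  · by_contra hne
    refine h.inv_mul_ratForm_ne (Subtype.coe_ne_coe.mpr hne) (i.2.trans j.2.symm) ?_
    have hcoe := (hc i).symm.trans ((congrArg Subtype.val hij).trans (hc j))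
    simpa only [sub_right_inj, i.2] using hcoe
  · exact (map_ne_zero _).mpr (inv_ne_zero (hpivot i))
  · have hi : algebraMap K (FractionRing (MvPolynomial (Fin k) K)) (G s i) ≠ 0 :=
      (map_ne_zero _).mpr (hpivot i)
    rw [IntermediateField.algebraMap_apply, hc, sub_sub_cancel, Algebra.smul_def,
      ← IsScalarTower.algebraMap_apply, map_inv₀, mul_inv, inv_inv, inv_mul_cancel_left₀ hi]

theorem linearIndependent_powerFamily_inv_ratForm (h : IsFiberTypePresentation G t I)
    (s : Fin k) : LinearIndependent (coordinateField K k s)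
      (powerFamily fun i : {i // t i = s} => (ratForm G i.1)⁻¹) := by
  obtain ⟨c, f, hc_inj, hf, hc⟩ := h.exists_injective_pole s
  rw [hc]
  exact linearIndependent_powerFamily_smul (linearIndependent_powerFamily_inv_sub
    (F := coordinateField K k s) (z := ratVar K s) (transcendental_ratVar s) hc_inj) hf

theorem injOn_orlikTeraoLift_succ (h : IsFiberTypePresentation G t I)
    (hI : I ≤ orlikTeraoIdeal (linearForms G)) (s : Fin k)
    (hs : Set.InjOn (orlikTeraoLift hI) (initialSubalgebra I t s)) :
    Set.InjOn (orlikTeraoLift hI) (initialSubalgebra I t (s + 1)) := by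
  rw [coe_initialSubalgebra_succ]
  refine injOn_adjoin_of_linearIndependent (orlikTeraoLift hI) hs
    (mapsTo_orlikTeraoLift hI h.eq_zero_of_lt s) (fun i j hij => ?_) ?_
  · exact h.mul_mem_span (Subtype.coe_ne_coe.mpr hij) (i.2.trans j.2.symm) (congrArg Fin.val i.2)
  · simp only [Function.comp_def, orlikTeraoLift_mk_X]
    exact h.linearIndependent_powerFamily_inv_ratForm s

theorem orlikTeraoIdeal_eq (h : IsFiberTypePresentation G t I)
    (hI : I ≤ orlikTeraoIdeal (linearForms G)) : orlikTeraoIdeal (linearForms G) = I := by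
  have hinj (s : ℕ) (hs : s ≤ k) : Set.InjOn (orlikTeraoLift hI) (initialSubalgebra I t s) := by
    induction s with
    | zero =>
      have hbot : initialSubalgebra I t 0 = ⊥ := by simp [initialSubalgebra]
      rw [hbot]
      rintro _ ⟨a, rfl⟩ _ ⟨b, rfl⟩ hab
      have : a = b := by simpa using hab
      rw [this]
    | succ s ih => exact h.injOn_orlikTeraoLift_succ hI ⟨s, hs⟩ (ih (Nat.le_of_succ_le hs))
  have htop : initialSubalgebra I t k = ⊤ := by
    have hgen := congrArg (Subalgebra.map (Ideal.Quotient.mkₐ K I))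
      (adjoin_range_X (σ := Fin n) (R := K))
    rw [AlgHom.map_adjoin, ← Set.range_comp, Algebra.map_top,
      AlgHom.range_eq_top _ |>.mpr (Ideal.Quotient.mkₐ_surjective K I)] at hgen
    simpa [initialSubalgebra, Function.comp_def] using hgen
  refine le_antisymm (fun p hp => ?_) hI
  rw [← Ideal.Quotient.eq_zero_iff_mem]
  have hinj := hinj k le_rfl
  rw [htop, Algebra.coe_top, Set.injOn_univ] at hinj
  exact hinj (by rw [map_zero]; exact hp)

end IsFiberTypePresentation

end FiberType

section MatrixResolution

open MvPolynomial

theorem range_mulVecLin_le_smul_top {R ι κ : Type*} [CommRing R] [Finite ι] [Fintype κ]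
    {D : Matrix ι κ R} {J : Ideal R} (hD : ∀ s t, D s t ∈ J) :
    LinearMap.range D.mulVecLin ≤ J • (⊤ : Submodule R (ι → R)) := by
  classical
  cases nonempty_fintype ι
  rw [Matrix.range_mulVecLin, Submodule.span_le]
  rintro _ ⟨t, rfl⟩
  rw [SetLike.mem_coe, ← Finset.univ_sum_single (D.col t)]
  refine sum_mem fun s _ => ?_
  have hsingle : Pi.single s (D.col t s) = D s t • (Pi.single s 1 : ι → R) := by
    rw [← Pi.single_smul', smul_eq_mul, mul_one, Matrix.col_apply]
  rw [hsingle]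
  exact Submodule.smul_mem_smul (hD s t) Submodule.mem_top

theorem exists_sigma_equiv_of_card_fiber {ι : Type*} [Fintype ι] (d : ι → ℕ) (b : ℕ → ℕ)
    (hb : ∀ j, b j = Fintype.card {t // d t = j}) :
    ∃ e : (Σ j, Fin (b j)) ≃ ι, ∀ p, d (e p) = p.1 := by
  refine ⟨(Equiv.sigmaCongrRight fun j => (finCongr (hb j)).trans
    (Fintype.equivFin {t // d t = j}).symm).trans (Equiv.sigmaFiberEquiv d), fun p => ?_⟩
  simpa using ((Fintype.equivFin {t // d t = p.1}).symm (finCongr (hb p.1) p.2)).2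

variable {K : Type*} [Field K] {n : ℕ}

theorem degree_eq_of_mem_support {σ : Type*} {f : MvPolynomial σ K} {a : ℕ}
    (hf : f.IsHomogeneous a) {m : σ →₀ ℕ} (hm : m ∈ f.support) : m.degree = a := by
  by_contra h
  exact mem_support_iff.mp hm (hf.coeff_eq_zero h)

theorem mem_span_X_of_isHomogeneous {f : MvPolynomial (Fin n) K} {a : ℕ} (ha : a ≠ 0)
    (hf : f.IsHomogeneous a) :
    f ∈ Ideal.span (Set.range (X : Fin n → MvPolynomial (Fin n) K)) := by
  rw [← Set.image_univ, mem_ideal_span_X_image]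
  intro m hm
  by_contra! h
  have hm0 : m = 0 := Finsupp.ext fun i => h i (Set.mem_univ i)
  exact ha (by rw [← degree_eq_of_mem_support hf hm, hm0, map_zero])

/-- `v` lies in the component of degree `e` of the graded free module with a basis indexed by `ι`
and degrees `d`. -/
def IsHomogeneousVec {ι : Type*} (d : ι → ℕ) (v : ι → MvPolynomial (Fin n) K) (e : ℕ) : Prop :=
  ∀ s, ∀ m ∈ (v s).support, m.degree + d s = e

theorem IsHomogeneousVec.mulVec {ι κ : Type*} [Fintype κ] {d : ι → ℕ} {d' : κ → ℕ}
    {D : Matrix ι κ (MvPolynomial (Fin n) K)} (hd : ∀ s t, d s ≤ d' t)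
    (hD : ∀ s t, (D s t).IsHomogeneous (d' t - d s)) {v : κ → MvPolynomial (Fin n) K} {e : ℕ}
    (hv : IsHomogeneousVec d' v e) : IsHomogeneousVec d (D.mulVec v) e := by
  classical
  intro s m hm
  obtain ⟨t, -, ht⟩ := Finset.mem_biUnion.mp (support_sum hm)
  obtain ⟨m₁, h₁, m₂, h₂, rfl⟩ := Finset.mem_add.mp (support_mul _ _ ht)
  have hm₁ := degree_eq_of_mem_support (hD s t) h₁
  have hm₂ := hv t m₂ h₂
  have := hd s t
  rw [map_add]
  omega

/-- The coordinates of `⨁ⱼ S(-j) ^ (b j)` indexed by `ι` instead of by `⟨j, t⟩`. -/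
noncomputable def gradedFreeEquiv (K : Type*) [Field K] (n : ℕ) {ι : Type*} [Finite ι]
    {b : ℕ → ℕ} (e : (Σ j, Fin (b j)) ≃ ι) :
    GradedFree K n b ≃ₗ[MvPolynomial (Fin n) K] (ι → MvPolynomial (Fin n) K) :=
  Finsupp.domLCongr e ≪≫ₗ Finsupp.linearEquivFunOnFinite _ _ _

theorem isHomogeneousVec_gradedFreeEquiv {ι : Type*} [Finite ι] {b : ℕ → ℕ} {d : ι → ℕ}
    {e : (Σ j, Fin (b j)) ≃ ι} (he : ∀ p, d (e p) = p.1) {v : GradedFree K n b} {a : ℕ} :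
    IsHomogeneousVec d (gradedFreeEquiv K n e v) a ↔ v.IsHomogeneous a := by
  refine e.symm.forall_congr fun s => ?_
  simp [gradedFreeEquiv, ← he]

theorem nonempty_minimalGradedFreeResolution_of_matrices {I : Ideal (MvPolynomial (Fin n) K)}
    {β : ℕ → ℕ → ℕ} {ι : ℕ → Type*} [∀ i, Fintype (ι i)] (d : ∀ i, ι i → ℕ)
    (hβ : ∀ i j, β i j = Fintype.card {t // d i t = j})
    (D : ∀ i, Matrix (ι i) (ι (i + 1)) (MvPolynomial (Fin n) K))
    (hd : ∀ i s t, d i s < d (i + 1) t)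
    (hD : ∀ i s t, (D i s t).IsHomogeneous (d (i + 1) t - d i s)) {o : ι 0} (ho : d 0 o = 0)
    (hexact₀ : Function.Exact (D 0).mulVecLin (Submodule.mkQ I ∘ₗ LinearMap.proj o))
    (hexact : ∀ i, Function.Exact (D (i + 1)).mulVecLin (D i).mulVecLin) :
    Nonempty (MinimalGradedFreeResolution (n := n) (M := MvPolynomial (Fin n) K ⧸ I)
      (fun e => (homogeneousSubmodule (Fin n) K e).map (Ideal.Quotient.mkₐ K I).toLinearMap)
      β) := by
  choose e he using fun i => exists_sigma_equiv_of_card_fiber (d i) (β i) (hβ i)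
  set Φ := fun i => gradedFreeEquiv K n (e i) with hΦ
  set aug := (Submodule.mkQ I ∘ₗ LinearMap.proj o) ∘ₗ (Φ 0).toLinearMap
  set diff := fun i => (Φ i).symm.toLinearMap ∘ₗ (D i).mulVecLin ∘ₗ (Φ (i + 1)).toLinearMap
    with hdiff
  have hΦ_diff (i : ℕ) : (D i).mulVecLin ∘ₗ (Φ (i + 1)).toLinearMap =
      (Φ i).toLinearMap ∘ₗ diff i := by ext; simp [hdiff]
  have hΦ_aug : (Submodule.mkQ I ∘ₗ LinearMap.proj o) ∘ₗ (Φ 0).toLinearMap =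
      (LinearEquiv.refl (MvPolynomial (Fin n) K) (_ ⧸ I)).toLinearMap ∘ₗ aug := rfl
  refine ⟨{ aug, diff, aug_homogeneous := fun v k hv => ?_, diff_homogeneous := fun i v k hv => ?_,
            aug_surjective := ?_, exact_zero := ?_, exact_succ := fun i => ?_,
            minimal := fun i => ?_ }⟩
  · refine Submodule.mem_map.mpr ⟨Φ 0 v o, ?_, rfl⟩
    intro m hm
    have := (isHomogeneousVec_gradedFreeEquiv (he 0)).mpr hv o m (mem_support_iff.mpr hm)
    rwa [ho, add_zero, Finsupp.degree_eq_weight_one] at this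
  · rw [← isHomogeneousVec_gradedFreeEquiv (he i)]
    have := ((isHomogeneousVec_gradedFreeEquiv (he (i + 1))).mpr hv).mulVec
      (fun s t => (hd i s t).le) (hD i)
    simpa [hdiff, hΦ] using this
  · exact ((Submodule.mkQ_surjective I).comp (LinearMap.proj_surjective o)).comp (Φ 0).surjective
  · exact (Function.Exact.iff_of_ladder_linearEquiv (hΦ_diff 0) hΦ_aug).mp hexact₀
  · exact (Function.Exact.iff_of_ladder_linearEquiv (hΦ_diff (i + 1)) (hΦ_diff i)).mp (hexact i)
  · have hrange := range_mulVecLin_le_smul_top fun s t =>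
      mem_span_X_of_isHomogeneous (Nat.sub_ne_zero_of_lt (hd i s t)) (hD i s t)
    rw [LinearMap.range_comp]
    refine (Submodule.map_mono ((LinearMap.range_comp_le_range _ _).trans hrange)).trans ?_
    rw [Submodule.map_smul'']
    exact Submodule.smul_mono le_rfl le_top

end MatrixResolution

section Cone

open Matrix

variable {S μ ρ π : Type*} [CommRing S]

/-- The first differential of the mapping cone of multiplication by `q` on the complex
`S ^ π → S ^ ρ → S ^ μ` given by the matrices `Φ` and `M`. -/
def coneFst [DecidableEq μ] (q : S) (M : Matrix μ ρ S) : Matrix μ (μ ⊕ ρ) S :=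
  fromCols (q • 1) M

/-- The second differential of the mapping cone of multiplication by `q`, see `coneFst`. -/
def coneSnd [DecidableEq ρ] (q : S) (M : Matrix μ ρ S) (Φ : Matrix ρ π S) :
    Matrix (μ ⊕ ρ) (π ⊕ ρ) S :=
  fromBlocks 0 M Φ (-q • 1)

/-- The third differential of the mapping cone of multiplication by `q`, see `coneFst`. -/
def coneTrd [DecidableEq π] (q : S) (Φ : Matrix ρ π S) : Matrix (π ⊕ ρ) π S :=
  fromRows (q • 1) Φ

theorem coneFst_mulVec [Fintype μ] [Fintype ρ] [DecidableEq μ] (q : S) (M : Matrix μ ρ S)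
    (x : μ → S) (f : ρ → S) : coneFst q M *ᵥ Sum.elim x f = q • x + M *ᵥ f := by
  simp [coneFst, smul_mulVec]

theorem coneSnd_mulVec [Fintype ρ] [Fintype π] [DecidableEq ρ] (q : S) (M : Matrix μ ρ S)
    (Φ : Matrix ρ π S) (w : π → S) (g : ρ → S) :
    coneSnd q M Φ *ᵥ Sum.elim w g = Sum.elim (M *ᵥ g) (Φ *ᵥ w - q • g) := by
  simp [coneSnd, fromBlocks_mulVec, neg_mulVec, smul_mulVec, sub_eq_add_neg]

theorem coneTrd_mulVec [Fintype π] [DecidableEq π] (q : S) (Φ : Matrix ρ π S) (v : π → S) :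
    coneTrd q Φ *ᵥ v = Sum.elim (q • v) (Φ *ᵥ v) := by
  simp [coneTrd, smul_mulVec]

theorem smul_vec_injective {q : S} (hq : q ∈ nonZeroDivisors S) :
    Function.Injective (q • · : (ρ → S) → ρ → S) := fun _ _ h =>
  funext fun s => (mul_cancel_left_mem_nonZeroDivisors hq).mp (congrFun h s)

theorem exists_smul_of_map_mk_eq_zero {q : S} {v : ρ → S}
    (h : Ideal.Quotient.mk (Ideal.span {q}) ∘ v = 0) : ∃ g, v = q • g := by
  have hdvd (s : ρ) : q ∣ v s :=
    Ideal.mem_span_singleton.mp (Ideal.Quotient.eq_zero_iff_mem.mp (congrFun h s))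
  choose g hg using hdvd
  exact ⟨g, funext hg⟩

theorem map_mk_smul_eq_zero (q : S) (v : ρ → S) :
    Ideal.Quotient.mk (Ideal.span {q}) ∘ (q • v) = 0 :=
  funext fun s => Ideal.Quotient.eq_zero_iff_mem.mpr (Ideal.mem_span_singleton.mpr ⟨v s, rfl⟩)

theorem comp_mulVec {R : Type*} [CommRing R] [Fintype ρ] (f : S →+* R) (M : Matrix μ ρ S)
    (v : ρ → S) : f ∘ (M *ᵥ v) = M.map f *ᵥ (f ∘ v) :=
  funext (RingHom.map_mulVec f M v)

theorem exact_coneFst_mkQ [Fintype ρ] (q : S) (m : ρ → S) :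
    Function.Exact (coneFst q (replicateRow Unit m)).mulVecLin
      (Submodule.mkQ (Ideal.span {q} ⊔ Ideal.span (Set.range m)) ∘ₗ LinearMap.proj ()) := by
  intro v
  have hmul (x : Unit → S) (f : ρ → S) :
      coneFst q (replicateRow Unit m) *ᵥ Sum.elim x f = fun _ => q * x () + m ⬝ᵥ f := by
    rw [coneFst_mulVec]; rfl
  rw [LinearMap.comp_apply, Submodule.mkQ_apply, Submodule.Quotient.mk_eq_zero,
    LinearMap.proj_apply, Submodule.mem_sup]
  constructor
  · rintro ⟨_, hx, _, hf, hv⟩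
    obtain ⟨x, rfl⟩ := Ideal.mem_span_singleton.mp hx
    obtain ⟨f, rfl⟩ := Submodule.mem_span_range_iff_exists_fun S |>.mp hf
    refine ⟨Sum.elim (fun _ => x) f, (hmul _ _).trans (funext fun _ => ?_)⟩
    simpa only [dotProduct, smul_eq_mul, mul_comm] using hv
  · rintro ⟨y, rfl⟩
    rw [← Sum.elim_comp_inl_inr y, mulVecLin_apply, hmul]
    exact ⟨_, Ideal.mem_span_singleton.mpr ⟨_, rfl⟩, _, sum_mem fun i _ =>
      Ideal.mul_mem_right _ _ (Ideal.subset_span ⟨i, rfl⟩), rfl⟩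

theorem coneTrd_mulVecLin_injective [Fintype π] [DecidableEq π] {q : S} (hq : q ∈ nonZeroDivisors S)
    {Φ : Matrix ρ π S} : Function.Injective (coneTrd q Φ).mulVecLin := by
  intro v w h
  simp only [mulVecLin_apply, coneTrd_mulVec, Sum.elim_eq_iff] at h
  exact smul_vec_injective hq h.1

variable [Fintype ρ] [Fintype π] {q : S} {M : Matrix μ ρ S} {Φ : Matrix ρ π S}

theorem exact_coneSnd_coneFst [Fintype μ] [DecidableEq μ] [DecidableEq ρ]
    (hq : q ∈ nonZeroDivisors S) (hMΦ : M * Φ = 0)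
    (hexact : Function.Exact (Φ.map (Ideal.Quotient.mk (Ideal.span {q}))).mulVecLin
      (M.map (Ideal.Quotient.mk (Ideal.span {q}))).mulVecLin) :
    Function.Exact (coneSnd q M Φ).mulVecLin (coneFst q M).mulVecLin := by
  have hcomp (w : π → S) : M *ᵥ (Φ *ᵥ w) = 0 := by rw [mulVec_mulVec, hMΦ, zero_mulVec]
  intro y
  rw [← Sum.elim_comp_inl_inr y, mulVecLin_apply, coneFst_mulVec]
  generalize y ∘ Sum.inl = x
  generalize y ∘ Sum.inr = f
  constructor
  · intro h
    have hf : M *ᵥ f = q • -x := by rw [smul_neg, eq_neg_of_add_eq_zero_right h]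
    obtain ⟨w', hw'⟩ := (hexact (Ideal.Quotient.mk _ ∘ f)).mp
      (by rw [mulVecLin_apply, ← comp_mulVec, hf, map_mk_smul_eq_zero])
    obtain ⟨w, rfl⟩ := Ideal.Quotient.mk_surjective.comp_left w'
    rw [mulVecLin_apply, ← comp_mulVec] at hw'
    obtain ⟨g, hg⟩ := exists_smul_of_map_mk_eq_zero (q := q) (v := Φ *ᵥ w - f)
      (funext fun s => by simpa [sub_eq_zero] using congrFun hw' s)
    have hx : M *ᵥ g = x := smul_vec_injective hq <| by
      simp only [← mulVec_smul, ← hg, mulVec_sub, hcomp, hf, smul_neg, zero_sub, neg_neg]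
    exact ⟨Sum.elim w g, by rw [mulVecLin_apply, coneSnd_mulVec, hx, ← hg, sub_sub_cancel]⟩
  · rintro ⟨z, hz⟩
    rw [← Sum.elim_comp_inl_inr z, mulVecLin_apply, coneSnd_mulVec, Sum.elim_eq_iff] at hz
    rw [← hz.1, ← hz.2, mulVec_sub, hcomp, mulVec_smul, zero_sub, add_neg_cancel]

theorem exact_coneTrd_coneSnd [DecidableEq ρ] [DecidableEq π]
    (hq : q ∈ nonZeroDivisors S) (hMΦ : M * Φ = 0)
    (hinj : Function.Injective (Φ.map (Ideal.Quotient.mk (Ideal.span {q}))).mulVecLin) :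
    Function.Exact (coneTrd q Φ).mulVecLin (coneSnd q M Φ).mulVecLin := by
  intro y
  rw [← Sum.elim_comp_inl_inr y, mulVecLin_apply, coneSnd_mulVec]
  generalize y ∘ Sum.inl = w
  generalize y ∘ Sum.inr = g
  constructor
  · intro h
    rw [← Sum.elim_zero_zero, Sum.elim_eq_iff] at h
    have hw : Φ *ᵥ w = q • g := sub_eq_zero.mp h.2
    obtain ⟨v, rfl⟩ := exists_smul_of_map_mk_eq_zero (q := q) (v := w) <| hinj <| by
      rw [map_zero, mulVecLin_apply, ← comp_mulVec, hw, map_mk_smul_eq_zero]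
    have hg : Φ *ᵥ v = g := smul_vec_injective hq ((mulVec_smul ..).symm.trans hw)
    exact ⟨v, by rw [mulVecLin_apply, coneTrd_mulVec, hg]⟩
  · rintro ⟨v, hv⟩
    rw [mulVecLin_apply, coneTrd_mulVec, Sum.elim_eq_iff] at hv
    rw [← hv.1, ← hv.2, mulVec_mulVec, hMΦ, zero_mulVec, mulVec_smul, sub_self,
      Sum.elim_zero_zero]

end Cone

section HilbertBurch

open Matrix

variable {R : Type*} [CommRing R]

theorem transpose_of_pair_mulVec (a b : Fin 3 → R) (w : Fin 2 → R) :
    (of ![a, b])ᵀ *ᵥ w = w 0 • a + w 1 • b := by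
  ext i
  simp [mulVec, dotProduct, Fin.sum_univ_two, mul_comm]

theorem replicateRow_cross_mul_transpose (a b : Fin 3 → R) :
    replicateRow Unit (a ⨯₃ b) * (of ![a, b])ᵀ = 0 := by
  ext _ j
  fin_cases j
  exacts [(dotProduct_comm _ _).trans (dot_self_cross a b),
    (dotProduct_comm _ _).trans (dot_cross_self a b)]

variable {a b : Fin 3 → R}

theorem transpose_of_pair_mulVecLin_injective (h₀ : (a ⨯₃ b) 0 ∈ nonZeroDivisors R) :
    Function.Injective ((of ![a, b])ᵀ).mulVecLin := by
  refine (injective_iff_map_eq_zero _).mpr fun w hw => ?_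
  rw [mulVecLin_apply, transpose_of_pair_mulVec] at hw
  have h1 : w 0 * a 1 + w 1 * b 1 = 0 := congrFun hw 1
  have h2 : w 0 * a 2 + w 1 * b 2 = 0 := congrFun hw 2
  have hminor : (a ⨯₃ b) 0 = a 1 * b 2 - a 2 * b 1 := by simp [cross_apply]
  rw [hminor] at h₀
  have cancel {x : R} (hx : (a 1 * b 2 - a 2 * b 1) * x = 0) : x = 0 :=
    (mem_nonZeroDivisors_iff.mp h₀).1 x hx
  have hw0 : w 0 = 0 := cancel (by linear_combination b 2 * h1 - b 1 * h2)
  have hw1 : w 1 = 0 := cancel (by linear_combination a 1 * h2 - a 2 * h1)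
  exact funext (Fin.forall_fin_two.mpr ⟨hw0, hw1⟩)

theorem exact_transpose_of_pair_cross (h₀ : (a ⨯₃ b) 0 ∈ nonZeroDivisors R)
    (h₁ : ∀ x, (a ⨯₃ b) 0 ∣ (a ⨯₃ b) 1 * x → (a ⨯₃ b) 0 ∣ x) :
    Function.Exact ((of ![a, b])ᵀ).mulVecLin (replicateRow Unit (a ⨯₃ b)).mulVecLin := by
  intro f
  constructor
  · intro h
    have hf : (a ⨯₃ b) ⬝ᵥ f = 0 := congrFun h ()
    simp only [cross_apply, dotProduct, Fin.sum_univ_three, cons_val] at hf h₀ h₁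
    obtain ⟨β, hβ⟩ := h₁ (a 1 * f 2 - a 2 * f 1)
      ⟨a 2 * f 0 - a 0 * f 2, by linear_combination -a 2 * hf⟩
    obtain ⟨α, hα⟩ := h₁ (b 1 * f 2 - b 2 * f 1)
      ⟨b 2 * f 0 - b 0 * f 2, by linear_combination -b 2 * hf⟩
    have cancel {x y : R} (hxy : (a 1 * b 2 - a 2 * b 1) * (x - y) = 0) : x = y :=
      sub_eq_zero.mp (mem_nonZeroDivisors_iff.mp h₀ |>.1 _ hxy)
    have hrow : ∀ i, -α * a i + β * b i = f i
      | 0 => cancel (by linear_combination a 0 * hα - b 0 * hβ - hf)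
      | 1 => cancel (by linear_combination a 1 * hα - b 1 * hβ)
      | 2 => cancel (by linear_combination a 2 * hα - b 2 * hβ)
    exact ⟨![-α, β], (transpose_of_pair_mulVec ..).trans (funext hrow)⟩
  · rintro ⟨w, rfl⟩
    rw [mulVecLin_apply, mulVecLin_apply, mulVec_mulVec, replicateRow_cross_mul_transpose,
      zero_mulVec]

end HilbertBurch

section QuadricAndMinors

open MvPolynomial Matrix

/-- The index types of the bases in the mapping cone of a quadric on the Hilbert–Burch complex of
a `3 × 2` matrix. -/
def QuadricConeIndex : ℕ → Type
  | 0 => Unit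
  | 1 => Unit ⊕ Fin 3
  | 2 => Fin 2 ⊕ Fin 3
  | 3 => Fin 2
  | _ + 4 => Empty

namespace QuadricConeIndex

instance : ∀ i, Fintype (QuadricConeIndex i)
  | 0 => inferInstanceAs (Fintype Unit)
  | 1 => inferInstanceAs (Fintype (Unit ⊕ Fin 3))
  | 2 => inferInstanceAs (Fintype (Fin 2 ⊕ Fin 3))
  | 3 => inferInstanceAs (Fintype (Fin 2))
  | _ + 4 => inferInstanceAs (Fintype Empty)

/-- The degrees of the basis elements, where the `3 × 2` matrix consists of linear forms. -/
def degree : ∀ i, QuadricConeIndex i → ℕ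
  | 0, _ => 0
  | 1, _ => 2
  | 2, .inl _ => 3
  | 2, .inr _ => 4
  | 3, _ => 5
  | _ + 4, _ => 0

theorem commonBettiTable_eq_card (i j : ℕ) :
    commonBettiTable i j = Fintype.card {t // degree i t = j} := by
  have hlarge (i : ℕ) (h : ∀ t, degree i t < 6) (hj : 6 ≤ j) :
      Fintype.card {t // degree i t = j} = 0 :=
    Fintype.card_eq_zero_iff.mpr ⟨fun t => (((h t.1).trans_le hj).ne t.2)⟩
  match i with
  | 0 | 1 | 2 | 3 =>
    by_cases hj : j < 6
    · interval_cases j <;> decide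
    · rw [hlarge _ (by decide) (by omega)]
      simp only [commonBettiTable]
      split <;> first | rfl | omega
  | i + 4 =>
    rw [Fintype.card_eq_zero_iff.mpr ⟨fun t => t.1.elim⟩]
    rfl

end QuadricConeIndex

/-- The differentials of the mapping cone of a quadric `q` on the Hilbert–Burch complex of the
matrix with columns `a` and `b`, extended by zero. -/
def quadricConeMatrix {S : Type*} [CommRing S] (q : S) (a b : Fin 3 → S) :
    ∀ i, Matrix (QuadricConeIndex i) (QuadricConeIndex (i + 1)) S
  | 0 => coneFst (μ := Unit) (ρ := Fin 3) q (replicateRow Unit (a ⨯₃ b))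
  | 1 => coneSnd (μ := Unit) (ρ := Fin 3) (π := Fin 2) q (replicateRow Unit (a ⨯₃ b)) (of ![a, b])ᵀ
  | 2 => coneTrd (ρ := Fin 3) (π := Fin 2) q (of ![a, b])ᵀ
  | _ + 3 => 0

theorem mk_span_singleton_dvd_mk_iff {S : Type*} [CommRing S] {q x y : S} :
    Ideal.Quotient.mk (Ideal.span {q}) x ∣ Ideal.Quotient.mk (Ideal.span {q}) y ↔
      y ∈ Ideal.span {q, x} := by
  rw [Ideal.mem_span_pair]
  constructor
  · rintro ⟨z, hz⟩
    obtain ⟨c, rfl⟩ := Ideal.Quotient.mk_surjective z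
    rw [← map_mul, Ideal.Quotient.mk_eq_mk_iff_sub_mem, Ideal.mem_span_singleton] at hz
    obtain ⟨d, hd⟩ := hz
    exact ⟨d, c, by linear_combination -hd⟩
  · rintro ⟨d, c, rfl⟩
    have hq : Ideal.Quotient.mk (Ideal.span {q}) q = 0 := Ideal.Quotient.mk_singleton_self q
    exact ⟨Ideal.Quotient.mk _ c, by
      rw [map_add, map_mul, map_mul, hq, mul_zero, zero_add, mul_comm]⟩

theorem mk_dvd_of_dvd_mul {S : Type*} [CommRing S] {q x y : S}
    (hprime : (Ideal.span {q, x}).IsPrime) (hy : y ∉ Ideal.span {q, x}) (z : S ⧸ Ideal.span {q})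
    (hz : Ideal.Quotient.mk (Ideal.span {q}) x ∣ Ideal.Quotient.mk (Ideal.span {q}) y * z) :
    Ideal.Quotient.mk (Ideal.span {q}) x ∣ z := by
  obtain ⟨w, rfl⟩ := Ideal.Quotient.mk_surjective z
  rw [← map_mul, mk_span_singleton_dvd_mk_iff] at hz
  exact mk_span_singleton_dvd_mk_iff.mpr ((hprime.mem_or_mem hz).resolve_left hy)

theorem comp_cross {R S : Type*} [CommRing R] [CommRing S] (f : S →+* R) (a b : Fin 3 → S) :
    f ∘ (a ⨯₃ b) = (f ∘ a) ⨯₃ (f ∘ b) := by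
  ext i
  fin_cases i <;> simp [cross_apply]

theorem map_transpose_of_pair {R S : Type*} [CommRing R] [CommRing S] (f : S →+* R)
    (a b : Fin 3 → S) : (of ![a, b])ᵀ.map f = (of ![f ∘ a, f ∘ b])ᵀ := by
  ext i j
  fin_cases j <;> rfl

theorem exact_quadricConeMatrix {S : Type*} [CommRing S] [IsDomain S] {q : S} {a b : Fin 3 → S}
    (hq : Prime q) (h₀ : ¬q ∣ (a ⨯₃ b) 0) (hprime : (Ideal.span {q, (a ⨯₃ b) 0}).IsPrime)
    (h₁ : (a ⨯₃ b) 1 ∉ Ideal.span {q, (a ⨯₃ b) 0}) (i : ℕ) :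
    Function.Exact (quadricConeMatrix q a b (i + 1)).mulVecLin
      (quadricConeMatrix q a b i).mulVecLin := by
  have hqS : q ∈ nonZeroDivisors S := mem_nonZeroDivisors_of_ne_zero hq.ne_zero
  set mk := Ideal.Quotient.mk (Ideal.span {q}) with hmk
  have : (Ideal.span {q}).IsPrime := (Ideal.span_singleton_prime hq.ne_zero).mpr hq
  have hcross (j : Fin 3) : ((mk ∘ a) ⨯₃ (mk ∘ b)) j = mk ((a ⨯₃ b) j) :=
    (congrFun (comp_cross mk a b) j).symm
  have h₀' : ((mk ∘ a) ⨯₃ (mk ∘ b)) 0 ∈ nonZeroDivisors (S ⧸ Ideal.span {q}) := by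
    rw [hcross]
    exact mem_nonZeroDivisors_of_ne_zero fun h =>
      h₀ (Ideal.mem_span_singleton.mp (Ideal.Quotient.eq_zero_iff_mem.mp h))
  have h₁' : ∀ z, ((mk ∘ a) ⨯₃ (mk ∘ b)) 0 ∣ ((mk ∘ a) ⨯₃ (mk ∘ b)) 1 * z →
      ((mk ∘ a) ⨯₃ (mk ∘ b)) 0 ∣ z := by
    rw [hcross, hcross]
    exact mk_dvd_of_dvd_mul hprime h₁
  have hcomp := replicateRow_cross_mul_transpose a b
  match i with
  | 0 =>
    refine exact_coneSnd_coneFst (μ := Unit) (ρ := Fin 3) hqS hcomp ?_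
    rw [← hmk, map_transpose_of_pair, show (replicateRow Unit (a ⨯₃ b)).map mk =
      replicateRow Unit (mk ∘ (a ⨯₃ b)) from rfl, comp_cross]
    exact exact_transpose_of_pair_cross h₀' h₁'
  | 1 =>
    refine exact_coneTrd_coneSnd (π := Fin 2) (ρ := Fin 3) hqS hcomp ?_
    rw [← hmk, map_transpose_of_pair]
    exact transpose_of_pair_mulVecLin_injective h₀'
  | 2 =>
    have hinj : Function.Injective (quadricConeMatrix q a b 2).mulVecLin :=
      coneTrd_mulVecLin_injective (π := Fin 2) hqS
    rw [show quadricConeMatrix q a b 3 = 0 from rfl, mulVecLin_zero]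
    exact LinearMap.exact_zero_iff_injective _ _ |>.mpr hinj
  | i + 3 =>
    rw [show quadricConeMatrix q a b (i + 3) = 0 from rfl, mulVecLin_zero]
    exact fun y => iff_of_true rfl ⟨0, funext fun t => t.elim⟩

variable {K : Type*} [Field K] {n : ℕ}

theorem isHomogeneous_cross {a b : Fin 3 → MvPolynomial (Fin n) K}
    (ha : ∀ i, (a i).IsHomogeneous 1) (hb : ∀ i, (b i).IsHomogeneous 1) (i : Fin 3) :
    ((a ⨯₃ b) i).IsHomogeneous 2 := by
  rw [cross_apply]
  fin_cases i <;> exact ((ha _).mul (hb _)).sub ((ha _).mul (hb _))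

theorem isHomogeneous_smul_one_apply {ι : Type*} [DecidableEq ι] {q : MvPolynomial (Fin n) K}
    {e : ℕ} (hq : q.IsHomogeneous e) (s t : ι) :
    ((q • (1 : Matrix ι ι (MvPolynomial (Fin n) K))) s t).IsHomogeneous e := by
  rw [Matrix.smul_apply, one_apply, smul_eq_mul, mul_ite, mul_one, mul_zero]
  split
  exacts [hq, isHomogeneous_zero _ _ _]

theorem isHomogeneous_quadricConeMatrix {q : MvPolynomial (Fin n) K}
    {a b : Fin 3 → MvPolynomial (Fin n) K} (hq : q.IsHomogeneous 2)
    (ha : ∀ i, (a i).IsHomogeneous 1) (hb : ∀ i, (b i).IsHomogeneous 1) :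
    ∀ i s t, (quadricConeMatrix q a b i s t).IsHomogeneous
      (QuadricConeIndex.degree (i + 1) t - QuadricConeIndex.degree i s) := by
  have hab (s : Fin 3) (t : Fin 2) : ((of ![a, b])ᵀ s t).IsHomogeneous 1 := by
    fin_cases t
    exacts [ha s, hb s]
  rintro (_ | _ | _ | i) s t
  · rcases t with t | t
    exacts [isHomogeneous_smul_one_apply (ι := Unit) hq s t, isHomogeneous_cross ha hb t]
  · rcases s with s | s <;> rcases t with t | t
    exacts [isHomogeneous_zero _ _ _, isHomogeneous_cross ha hb t, hab s t,
      isHomogeneous_smul_one_apply (ι := Fin 3) hq.neg s t]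
  · rcases s with s | s
    exacts [isHomogeneous_smul_one_apply (ι := Fin 2) hq s t, hab s t]
  · exact isHomogeneous_zero _ _ _

theorem isOrlikTeraoBetti_commonBettiTable {k : ℕ} {ℓ : Fin n → MvPolynomial (Fin k) K}
    {q : MvPolynomial (Fin n) K} {a b : Fin 3 → MvPolynomial (Fin n) K}
    (hI : orlikTeraoIdeal ℓ = Ideal.span {q} ⊔ Ideal.span (Set.range (a ⨯₃ b)))
    (hq₂ : q.IsHomogeneous 2) (ha : ∀ i, (a i).IsHomogeneous 1) (hb : ∀ i, (b i).IsHomogeneous 1)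
    (hq : Prime q) (h₀ : ¬q ∣ (a ⨯₃ b) 0) (hprime : (Ideal.span {q, (a ⨯₃ b) 0}).IsPrime)
    (h₁ : (a ⨯₃ b) 1 ∉ Ideal.span {q, (a ⨯₃ b) 0}) :
    IsOrlikTeraoBetti ℓ commonBettiTable := by
  have hres := nonempty_minimalGradedFreeResolution_of_matrices
    (I := Ideal.span {q} ⊔ Ideal.span (Set.range (a ⨯₃ b))) QuadricConeIndex.degree
    QuadricConeIndex.commonBettiTable_eq_card (quadricConeMatrix q a b) ?_
    (isHomogeneous_quadricConeMatrix hq₂ ha hb) (o := ()) rfl (exact_coneFst_mkQ q (a ⨯₃ b))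
    (exact_quadricConeMatrix hq h₀ hprime h₁)
  · rw [← hI] at hres
    exact hres
  · rintro (_ | _ | _ | i) s t
    · exact two_pos
    · rcases t with _ | _
      exacts [(by decide : 2 < 3), (by decide : 2 < 4)]
    · rcases s with _ | _
      exacts [(by decide : 3 < 5), (by decide : 4 < 5)]
    · exact t.elim

end QuadricAndMinors

section Arrangements

open MvPolynomial Matrix

variable {K : Type*} [Field K] {n k : ℕ}

theorem notMem_span_of_eval {σ : Type*} {s : Set (MvPolynomial σ K)} {g : MvPolynomial σ K}
    (v : σ → K) (hs : ∀ f ∈ s, eval v f = 0) (hg : eval v g ≠ 0) : g ∉ Ideal.span s := fun h =>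
  hg (RingHom.mem_ker.mp (Ideal.span_le (I := RingHom.ker (eval v)).mpr hs h))

theorem IsFiberTypePresentation.isPrime {G : Matrix (Fin k) (Fin n) K} {t : Fin n → Fin k}
    {I : Ideal (MvPolynomial (Fin n) K)} (h : IsFiberTypePresentation G t I)
    (hI : I ≤ orlikTeraoIdeal (linearForms G)) : I.IsPrime := by
  rw [← h.orlikTeraoIdeal_eq hI]
  exact RingHom.ker_isPrime _

variable (K)

/-- The coefficients of `x, y, z, x - y, x - z, y - z`. -/
def braidMatrix : Matrix (Fin 3) (Fin 6) K :=
  !![1, 0, 0, 1, 1, 0; 0, 1, 0, -1, 0, 1; 0, 0, 1, 0, -1, -1]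

/-- The coefficients of `x, y, z, x - y, x - z, w`, which share with the braid arrangement the
relations among the first five forms and no others. Its Orlik–Terao ideal exhibits the ideal of
`braidQuadric` and the first minor as prime. -/
def truncatedBraidMatrix : Matrix (Fin 4) (Fin 6) K :=
  !![1, 0, 0, 1, 1, 0; 0, 1, 0, -1, 0, 0; 0, 0, 1, 0, -1, 0; 0, 0, 0, 0, 0, 1]

/-- The quadric of the relation `y + (x - y) - x = 0`. -/
noncomputable def braidQuadric : MvPolynomial (Fin 6) K :=
  circuitQuadric 1 3 0 1 1 (-1)

/-- The first column of a matrix whose minors, together with `braidQuadric`, generate the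
Orlik–Terao ideal of the braid arrangement. -/
noncomputable def braidColumn₁ : Fin 3 → MvPolynomial (Fin 6) K :=
  ![X 5 - X 1, X 0 - X 4, X 0 - X 1]

/-- The second column of the matrix with first column `braidColumn₁`. -/
noncomputable def braidColumn₂ : Fin 3 → MvPolynomial (Fin 6) K :=
  ![X 5 + X 3, X 0 - X 3, X 0 - X 2]

theorem braidColumn_cross : braidColumn₁ K ⨯₃ braidColumn₂ K =
    ![braidQuadric K - circuitQuadric 2 4 0 1 1 (-1),
      braidQuadric K - circuitQuadric 2 5 1 1 1 (-1),
      -circuitQuadric 4 5 3 1 (-1) (-1) - braidQuadric K] := by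
  simp only [cross_apply, braidColumn₁, braidColumn₂, braidQuadric, circuitQuadric, cons_val,
    map_one, map_neg]
  congrm ![?_, ?_, ?_] <;> ring

theorem isFiberTypePresentation_truncatedBraidMatrix :
    IsFiberTypePresentation (truncatedBraidMatrix K) ![0, 1, 2, 1, 2, 3]
      (Ideal.span {braidQuadric K, circuitQuadric 2 4 0 1 1 (-1)}) where
  pivot_ne_zero i := by fin_cases i <;> simp [truncatedBraidMatrix]
  eq_zero_of_lt i r h := by
    fin_cases i <;> fin_cases r <;> first | rfl | exact absurd h (by decide)
  exists_circuit i j hij ht := by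
    fin_cases i <;> fin_cases j <;>
      first | exact absurd hij (by decide) | exact absurd ht (by decide) | skip
    · exact ⟨0, 1, 1, -1, by decide, by simp, by simp [Fin.forall_fin_succ, truncatedBraidMatrix],
        Ideal.subset_span (Or.inl rfl)⟩
    · exact ⟨0, 1, 1, -1, by decide, by simp, by simp [Fin.forall_fin_succ, truncatedBraidMatrix],
        Ideal.subset_span (Or.inr rfl)⟩

/-- The ideal of `braidQuadric` and the minors, eventually the Orlik–Terao ideal of the braid
arrangement. -/
noncomputable def braidIdeal : Ideal (MvPolynomial (Fin 6) K) :=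
  Ideal.span {braidQuadric K} ⊔ Ideal.span (Set.range (braidColumn₁ K ⨯₃ braidColumn₂ K))

theorem isFiberTypePresentation_braidMatrix :
    IsFiberTypePresentation (braidMatrix K) ![0, 1, 2, 1, 2, 2] (braidIdeal K) where
  pivot_ne_zero i := by fin_cases i <;> simp [braidMatrix]
  eq_zero_of_lt i r h := by
    fin_cases i <;> fin_cases r <;> first | rfl | exact absurd h (by decide)
  exists_circuit i j hij ht := by
    have hq : braidQuadric K ∈ braidIdeal K :=
      Ideal.mem_sup_left (Ideal.mem_span_singleton_self _)
    have hm (s : Fin 3) : (braidColumn₁ K ⨯₃ braidColumn₂ K) s ∈ braidIdeal K :=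
      Ideal.mem_sup_right (Ideal.subset_span ⟨s, rfl⟩)
    rw [braidColumn_cross] at hm
    fin_cases i <;> fin_cases j <;>
      first | exact absurd hij (by decide) | exact absurd ht (by decide) | skip
    · exact ⟨0, 1, 1, -1, by decide, by simp, by simp [Fin.forall_fin_succ, braidMatrix], hq⟩
    · exact ⟨0, 1, 1, -1, by decide, by simp, by simp [Fin.forall_fin_succ, braidMatrix],
        by simpa using sub_mem hq (hm 0)⟩
    · exact ⟨1, 1, 1, -1, by decide, by simp, by simp [Fin.forall_fin_succ, braidMatrix],
        by simpa using sub_mem hq (hm 1)⟩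
    · exact ⟨3, 1, -1, -1, by decide, by simp, by simp [Fin.forall_fin_succ, braidMatrix],
        by simpa using add_mem (hm 2) hq⟩

theorem isPrime_span_truncatedBraid :
    (Ideal.span {braidQuadric K, circuitQuadric 2 4 0 1 1 (-1)}).IsPrime := by
  have h := isFiberTypePresentation_truncatedBraidMatrix K
  exact h.isPrime (Ideal.span_le.mpr (Set.pair_subset
    (h.circuitQuadric_mem (by simp [Fin.forall_fin_succ, truncatedBraidMatrix]))
    (h.circuitQuadric_mem (by simp [Fin.forall_fin_succ, truncatedBraidMatrix]))))

theorem orlikTeraoIdeal_braidMatrix :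
    orlikTeraoIdeal (linearForms (braidMatrix K)) = braidIdeal K := by
  have h := isFiberTypePresentation_braidMatrix K
  have hq : braidQuadric K ∈ orlikTeraoIdeal (linearForms (braidMatrix K)) :=
    h.circuitQuadric_mem (by simp [Fin.forall_fin_succ, braidMatrix])
  refine h.orlikTeraoIdeal_eq (sup_le ((Ideal.span_singleton_le_iff_mem _).mpr hq) ?_)
  rw [Ideal.span_le, Set.range_subset_iff, braidColumn_cross]
  simp only [Fin.forall_fin_succ, IsEmpty.forall_iff, and_true]
  exact ⟨sub_mem hq (h.circuitQuadric_mem (by simp [Fin.forall_fin_succ, braidMatrix])),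
    sub_mem hq (h.circuitQuadric_mem (by simp [Fin.forall_fin_succ, braidMatrix])),
    sub_mem (neg_mem (h.circuitQuadric_mem (by simp [Fin.forall_fin_succ, braidMatrix]))) hq⟩

theorem isOrlikTeraoBetti_braidMatrix :
    IsOrlikTeraoBetti (linearForms (braidMatrix K)) commonBettiTable := by
  have hX := isHomogeneous_X (σ := Fin 6) K
  have hspan : Ideal.span {braidQuadric K, (braidColumn₁ K ⨯₃ braidColumn₂ K) 0} =
      Ideal.span {braidQuadric K, circuitQuadric 2 4 0 1 1 (-1)} := by
    simp [braidColumn_cross, sub_eq_add_neg]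
  refine isOrlikTeraoBetti_commonBettiTable (orlikTeraoIdeal_braidMatrix K)
    (isHomogeneous_circuitQuadric ..) (fun i => ?_) (fun i => ?_)
    (prime_circuitQuadric (by decide) (by decide) (by decide) (by simp) (by simp) (by simp)) ?_
    (hspan ▸ isPrime_span_truncatedBraid K) ?_
  · fin_cases i <;> exact (hX _).sub (hX _)
  · fin_cases i
    exacts [(hX _).add (hX _), (hX _).sub (hX _), (hX _).sub (hX _)]
  · rw [← Ideal.mem_span_singleton]
    refine notMem_span_of_eval ![0, 0, 1, 0, 1, 0] ?_ ?_ <;>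
      simp [braidColumn_cross, braidQuadric, circuitQuadric]
  · rw [hspan]
    refine notMem_span_of_eval ![0, 0, 1, 0, 0, 1] ?_ ?_ <;>
      simp [braidColumn_cross, braidQuadric, circuitQuadric]

/-- The coefficients of `x, y, x + y, x - y, z, y - z`. -/
def pencilMatrix : Matrix (Fin 3) (Fin 6) K :=
  !![1, 0, 1, 1, 0, 0; 0, 1, 1, -1, 0, 1; 0, 0, 0, 0, 1, -1]

/-- The coefficients of `x, y, x + u, x - u, z, y - z` in the variables `x, y, z, u`, whose only
relations are those of the three forms `x, x + u, x - u` and of the three forms `y, z, y - z`. Its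
Orlik–Terao ideal exhibits the ideal of `pencilQuadric` and the first minor as prime. -/
def detachedPencilMatrix : Matrix (Fin 4) (Fin 6) K :=
  !![1, 0, 1, 1, 0, 0; 0, 1, 0, 0, 0, 1; 0, 0, 0, 0, 1, -1; 0, 0, 1, -1, 0, 0]

/-- The quadric of the relation `z + (y - z) - y = 0`. -/
noncomputable def pencilQuadric : MvPolynomial (Fin 6) K :=
  circuitQuadric 4 5 1 1 1 (-1)

/-- The first column of a matrix whose minors are the quadrics of the relations among
`x, y, x + y, x - y`. -/
noncomputable def pencilColumn₁ : Fin 3 → MvPolynomial (Fin 6) K :=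
  ![X 0, X 0 - X 2, X 3 - X 0]

/-- The second column of the matrix with first column `pencilColumn₁`. -/
noncomputable def pencilColumn₂ : Fin 3 → MvPolynomial (Fin 6) K :=
  ![X 1, X 2, X 3]

theorem pencilColumn_cross : pencilColumn₁ K ⨯₃ pencilColumn₂ K =
    ![circuitQuadric 2 3 0 1 1 (-2), circuitQuadric 1 3 0 (-1) (-1) 1,
      circuitQuadric 1 2 0 1 (-1) 1] := by
  simp only [cross_apply, pencilColumn₁, pencilColumn₂, circuitQuadric, cons_val,
    map_one, map_neg, map_ofNat]
  congrm ![?_, ?_, ?_] <;> ring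

/-- The ideal of `pencilQuadric` and the minors, eventually the Orlik–Terao ideal of
`x, y, x + y, x - y, z, y - z`. -/
noncomputable def pencilIdeal : Ideal (MvPolynomial (Fin 6) K) :=
  Ideal.span {pencilQuadric K} ⊔ Ideal.span (Set.range (pencilColumn₁ K ⨯₃ pencilColumn₂ K))

variable {K}

theorem isFiberTypePresentation_detachedPencilMatrix (hK : (2 : K) ≠ 0) :
    IsFiberTypePresentation (detachedPencilMatrix K) ![0, 1, 3, 3, 2, 2]
      (Ideal.span {pencilQuadric K, circuitQuadric 2 3 0 1 1 (-2)}) where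
  pivot_ne_zero i := by fin_cases i <;> simp [detachedPencilMatrix]
  eq_zero_of_lt i r h := by
    fin_cases i <;> fin_cases r <;> first | rfl | exact absurd h (by decide)
  exists_circuit i j hij ht := by
    fin_cases i <;> fin_cases j <;>
      first | exact absurd hij (by decide) | exact absurd ht (by decide) | skip
    · exact ⟨0, 1, 1, -2, by decide, neg_ne_zero.mpr hK, by
        simp [Fin.forall_fin_succ, detachedPencilMatrix, one_add_one_eq_two],
        Ideal.subset_span (Or.inr rfl)⟩
    · exact ⟨1, 1, 1, -1, by decide, by simp, by simp [Fin.forall_fin_succ, detachedPencilMatrix],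
        Ideal.subset_span (Or.inl rfl)⟩

theorem isPrime_span_detachedPencil (hK : (2 : K) ≠ 0) :
    (Ideal.span {pencilQuadric K, circuitQuadric 2 3 0 1 1 (-2)}).IsPrime := by
  have h := isFiberTypePresentation_detachedPencilMatrix hK
  exact h.isPrime (Ideal.span_le.mpr (Set.pair_subset
    (h.circuitQuadric_mem (by simp [Fin.forall_fin_succ, detachedPencilMatrix]))
    (h.circuitQuadric_mem
      (by simp [Fin.forall_fin_succ, detachedPencilMatrix, one_add_one_eq_two]))))

theorem isFiberTypePresentation_pencilMatrix (hK : (2 : K) ≠ 0) :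
    IsFiberTypePresentation (pencilMatrix K) ![0, 1, 1, 1, 2, 2] (pencilIdeal K) where
  pivot_ne_zero i := by fin_cases i <;> simp [pencilMatrix]
  eq_zero_of_lt i r h := by
    fin_cases i <;> fin_cases r <;> first | rfl | exact absurd h (by decide)
  exists_circuit i j hij ht := by
    have hm (s : Fin 3) : (pencilColumn₁ K ⨯₃ pencilColumn₂ K) s ∈ pencilIdeal K :=
      Ideal.mem_sup_right (Ideal.subset_span ⟨s, rfl⟩)
    rw [pencilColumn_cross] at hm
    fin_cases i <;> fin_cases j <;>
      first | exact absurd hij (by decide) | exact absurd ht (by decide) | skip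
    · exact ⟨0, 1, -1, 1, by decide, by simp, by simp [Fin.forall_fin_succ, pencilMatrix], hm 2⟩
    · exact ⟨0, -1, -1, 1, by decide, by simp, by simp [Fin.forall_fin_succ, pencilMatrix], hm 1⟩
    · exact ⟨0, 1, 1, -2, by decide, neg_ne_zero.mpr hK,
        by simp [Fin.forall_fin_succ, pencilMatrix, one_add_one_eq_two], hm 0⟩
    · exact ⟨1, 1, 1, -1, by decide, by simp, by simp [Fin.forall_fin_succ, pencilMatrix],
        Ideal.mem_sup_left (Ideal.mem_span_singleton_self _)⟩

theorem orlikTeraoIdeal_pencilMatrix (hK : (2 : K) ≠ 0) :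
    orlikTeraoIdeal (linearForms (pencilMatrix K)) = pencilIdeal K := by
  have h := isFiberTypePresentation_pencilMatrix hK
  refine h.orlikTeraoIdeal_eq (sup_le ((Ideal.span_singleton_le_iff_mem _).mpr
    (h.circuitQuadric_mem (by simp [Fin.forall_fin_succ, pencilMatrix]))) ?_)
  rw [Ideal.span_le, Set.range_subset_iff, pencilColumn_cross]
  simp only [Fin.forall_fin_succ, IsEmpty.forall_iff, and_true]
  exact ⟨h.circuitQuadric_mem (by simp [Fin.forall_fin_succ, pencilMatrix, one_add_one_eq_two]),
    h.circuitQuadric_mem (by simp [Fin.forall_fin_succ, pencilMatrix]),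
    h.circuitQuadric_mem (by simp [Fin.forall_fin_succ, pencilMatrix])⟩

theorem isOrlikTeraoBetti_pencilMatrix (hK : (2 : K) ≠ 0) :
    IsOrlikTeraoBetti (linearForms (pencilMatrix K)) commonBettiTable := by
  have hX := isHomogeneous_X (σ := Fin 6) K
  have hspan : Ideal.span {pencilQuadric K, (pencilColumn₁ K ⨯₃ pencilColumn₂ K) 0} =
      Ideal.span {pencilQuadric K, circuitQuadric 2 3 0 1 1 (-2)} := by
    simp only [pencilColumn_cross, cons_val_zero]
  refine isOrlikTeraoBetti_commonBettiTable (orlikTeraoIdeal_pencilMatrix hK)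
    (isHomogeneous_circuitQuadric ..) (fun i => ?_) (fun i => ?_)
    (prime_circuitQuadric (by decide) (by decide) (by decide) (by simp) (by simp) (by simp)) ?_
    (hspan ▸ isPrime_span_detachedPencil hK) ?_
  · fin_cases i
    exacts [hX _, (hX _).sub (hX _), (hX _).sub (hX _)]
  · fin_cases i <;> exact hX _
  · rw [← Ideal.mem_span_singleton]
    refine notMem_span_of_eval ![0, 0, 1, 1, 0, 0] ?_ ?_ <;>
      simp [pencilColumn_cross, pencilQuadric, circuitQuadric, hK]
  · rw [hspan]
    refine notMem_span_of_eval ![1, 1, 0, 0, 0, 0] ?_ ?_ <;>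
      simp [pencilColumn_cross, pencilQuadric, circuitQuadric]

end Arrangements

section Codes

open MvPolynomial Matrix

variable {K : Type*} [Field K] {n k : ℕ}

theorem isRelPrime_linearForms {G : Matrix (Fin k) (Fin n) K} {i j : Fin n}
    (h : ∃ r s, G r i * G s j ≠ G s i * G r j) :
    IsRelPrime (linearForms G i) (linearForms G j) := by
  obtain ⟨r, s, h⟩ := h
  have heval (v : Fin k → K) (l : Fin n) : eval v (linearForms G l) = ∑ a, G a l * v a := by
    simp [linearForms]
  have hker (l : Fin n) : eval (Pi.single r (G s i) - Pi.single s (G r i)) (linearForms G l) =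
      G r l * G s i - G s l * G r i := by
    simp [heval, mul_sub, Pi.single_apply]
  have hirr : Irreducible (linearForms G i) := by
    refine irreducible_of_isHomogeneous_one (.sum _ _ _ fun a _ => isHomogeneous_C_mul_X _ a) ?_
    intro h0
    have hcoeff (a : Fin k) : G a i = 0 := by
      simpa [heval, Pi.single_apply] using congrArg (eval (Pi.single a 1)) h0
    simp [hcoeff] at h
  refine isRelPrime_of_eval hirr _ ((hker i).trans (by ring)) ?_
  rw [hker, sub_ne_zero]
  contrapose! h
  linear_combination -h

theorem linearForms_braidMatrix : linearForms (braidMatrix K) =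
    ![X 0, X 1, X 2, X 0 - X 1, X 0 - X 2, X 1 - X 2] := by
  funext j
  fin_cases j <;> simp [linearForms, braidMatrix, Fin.sum_univ_three, sub_eq_add_neg]

theorem linearForms_pencilMatrix : linearForms (pencilMatrix K) =
    ![X 0, X 1, X 0 + X 1, X 0 - X 1, X 2, X 1 - X 2] := by
  funext j
  fin_cases j <;> simp [linearForms, pencilMatrix, Fin.sum_univ_three, sub_eq_add_neg]

theorem pairwise_isRelPrime_braidMatrix :
    Pairwise fun i j =>
      IsRelPrime (linearForms (braidMatrix K) i) (linearForms (braidMatrix K) j) := by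
  refine fun i j hij => isRelPrime_linearForms ?_
  fin_cases i <;> fin_cases j <;>
    first | exact absurd rfl hij | simp [Fin.exists_fin_succ, braidMatrix]

theorem pairwise_isRelPrime_pencilMatrix (hK : (2 : K) ≠ 0) :
    Pairwise fun i j =>
      IsRelPrime (linearForms (pencilMatrix K) i) (linearForms (pencilMatrix K) j) := by
  have h : (-1 : K) ≠ 1 := fun h => hK (by linear_combination -h)
  refine fun i j hij => isRelPrime_linearForms ?_
  fin_cases i <;> fin_cases j <;>
    first | exact absurd rfl hij | simp [Fin.exists_fin_succ, pencilMatrix, h, h.symm]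

theorem vecMul_braidMatrix (v : Fin 3 → K) :
    v ᵥ* braidMatrix K = ![v 0, v 1, v 2, v 0 - v 1, v 0 - v 2, v 1 - v 2] := by
  funext i
  fin_cases i <;>
    simp [braidMatrix, vecMul, dotProduct, Fin.sum_univ_three, sub_eq_add_neg]

theorem vecMul_pencilMatrix (v : Fin 3 → K) :
    v ᵥ* pencilMatrix K = ![v 0, v 1, v 0 + v 1, v 0 - v 1, v 2, v 1 - v 2] := by
  funext i
  fin_cases i <;>
    simp [pencilMatrix, vecMul, dotProduct, Fin.sum_univ_three, sub_eq_add_neg]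

variable [DecidableEq K]

theorem isLinearCode_matrixCode {G : Matrix (Fin k) (Fin n) K} {d : ℕ} (hd : 0 < d)
    (hle : ∀ v, v ≠ 0 → d ≤ hammingNorm (v ᵥ* G)) (heq : ∃ v, hammingNorm (v ᵥ* G) = d) :
    IsLinearCode (matrixCode G) k d := by
  have hinj : ∀ v, v ᵥ* G = 0 → v = 0 := fun v hv => by
    by_contra hne
    exact (hd.trans_le (hle v hne)).ne' (hammingNorm_eq_zero.mpr hv)
  obtain ⟨v, hv⟩ := heq
  refine ⟨?_, ⟨v ᵥ* G, ⟨v, rfl⟩, hammingNorm_pos_iff.mp (hv ▸ hd), hv⟩, ?_⟩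
  · rw [matrixCode, LinearMap.finrank_range_of_inj, Module.finrank_fin_fun]
    exact (injective_iff_map_eq_zero G.vecMulLinear).mpr hinj
  · rintro _ ⟨_, ⟨v, rfl⟩, hne, rfl⟩
    exact hle v fun h => hne (by rw [h, map_zero])

theorem isLinearCode_braidMatrix : IsLinearCode (matrixCode (braidMatrix K)) 3 3 := by
  refine isLinearCode_matrixCode three_pos (fun v hv => ?_) ⟨![1, 0, 0], ?_⟩ <;>
    rw [vecMul_braidMatrix, hammingNorm, Finset.card_filter, Fin.sum_univ_six]
  · have hv : v 0 ≠ 0 ∨ v 1 ≠ 0 ∨ v 2 ≠ 0 := by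
      simpa [funext_iff, Fin.forall_fin_succ, imp_iff_not_or] using hv
    simp only [cons_val, sub_ne_zero]
    grind
  · simp

theorem isLinearCode_pencilMatrix : IsLinearCode (matrixCode (pencilMatrix K)) 3 2 := by
  refine isLinearCode_matrixCode two_pos (fun v hv => ?_) ⟨![0, 0, 1], ?_⟩ <;>
    rw [vecMul_pencilMatrix, hammingNorm, Finset.card_filter, Fin.sum_univ_six]
  · have hv : v 0 ≠ 0 ∨ v 1 ≠ 0 ∨ v 2 ≠ 0 := by
      simpa [funext_iff, Fin.forall_fin_succ, imp_iff_not_or] using hv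
    simp only [cons_val, sub_ne_zero]
    grind
  · simp

end Codes

theorem proposition3p11 {K : Type*} [Field K] [DecidableEq K] (hK : (2 : K) ≠ 0) :
    (∃ G₁ G₂ : Matrix (Fin 3) (Fin 6) K,
      linearForms G₁ =
        ![MvPolynomial.X 0, MvPolynomial.X 1, MvPolynomial.X 2,
          MvPolynomial.X 0 - MvPolynomial.X 1, MvPolynomial.X 0 - MvPolynomial.X 2,
          MvPolynomial.X 1 - MvPolynomial.X 2] ∧
      linearForms G₂ =
        ![MvPolynomial.X 0, MvPolynomial.X 1, MvPolynomial.X 0 + MvPolynomial.X 1,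
          MvPolynomial.X 0 - MvPolynomial.X 1, MvPolynomial.X 2,
          MvPolynomial.X 1 - MvPolynomial.X 2] ∧
      Pairwise (fun i j => IsRelPrime (linearForms G₁ i) (linearForms G₁ j)) ∧
      Pairwise (fun i j => IsRelPrime (linearForms G₂ i) (linearForms G₂ j)) ∧
      IsLinearCode (matrixCode G₁) 3 3 ∧
      IsLinearCode (matrixCode G₂) 3 2 ∧
      IsOrlikTeraoBetti (linearForms G₁) commonBettiTable ∧
      IsOrlikTeraoBetti (linearForms G₂) commonBettiTable) ∧
    ¬ ∃ f : ℕ → ℕ → (ℕ → ℕ → ℕ) → ℕ,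
      ∀ (n k d : ℕ) (G : Matrix (Fin k) (Fin n) K) (β : ℕ → ℕ → ℕ),
        IsLinearCode (matrixCode G) k d →
        Pairwise (fun i j => IsRelPrime (linearForms G i) (linearForms G j)) →
        IsOrlikTeraoBetti (linearForms G) β →
        d = f n k β := by
  have P₁ := pairwise_isRelPrime_braidMatrix (K := K)
  have P₂ := pairwise_isRelPrime_pencilMatrix hK
  have B₁ := isOrlikTeraoBetti_braidMatrix K
  have B₂ := isOrlikTeraoBetti_pencilMatrix hK
  refine ⟨⟨braidMatrix K, pencilMatrix K, linearForms_braidMatrix, linearForms_pencilMatrix, P₁, P₂,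
    isLinearCode_braidMatrix, isLinearCode_pencilMatrix, B₁, B₂⟩, ?_⟩
  rintro ⟨f, hf⟩
  have h := (hf 6 3 3 _ _ isLinearCode_braidMatrix P₁ B₁).trans
    (hf 6 3 2 _ _ isLinearCode_pencilMatrix P₂ B₂).symm
  omega
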